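/- Let $n,m$ be nonnegative integers and let $A\in\mathbb{R}^{n\times m}$. The qualitative class $\mathcal{Q}(A)$ is the set of all $B\in\mathbb{R}^{n\times m}$ whose entries have the same signs ($+$, $-$ or $0$) as the corresponding entries of $A$. For each integer $k\ge 1$ let $$\mathcal{Q}^{2k}(A)=\{A_1A_2^{\mathrm t}A_3A_4^{\mathrm t}\cdots A_{2k-1}A_{2k}^{\mathrm t} : A_i\in\mathcal{Q}(A),\ i=1,\dots,2k\}\subseteq\mathbb{R}^{n\times n}.$$ Let $\mathbf{P_0}$ be the set of real square matrices all of whose principal minors are nonnegative, and let $\mathbf{PS}$ be the set of real square matrices all of whose complex eigenvalues are real and nonnegative. Let $\Gamma_A$ be the bipartite graph with vertices $X_1,\dots,X_n,Y_1,\dots,Y_m$ and with an edge $X_iY_j$ if and only if $A_{ij}\neq 0$. A caterpillar is a tree which becomes a path (possibly with a single vertex or with no vertex) on removal of its leaves (the vertices of degree $1$); a caterpillar forest is an acyclic graph each of whose connected components is a caterpillar. The following five conditions are equivalent: (a) $\Gamma_A$ is a caterpillar forest; (b) $\mathcal{Q}^{6}(A)\subseteq\mathbf{P_0}$; (c) $\mathcal{Q}^{4}(A)\subseteq\mathbf{PS}$;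 (d) $\mathcal{Q}^{2k}(A)\subseteq\mathbf{P_0}$ for all integers $k\ge 1$; (e) $\mathcal{Q}^{2k}(A)\subseteq\mathbf{PS}$ for all integers $k\ge 1$. -/

import Mathlib

open Matrix

/-- The sign-pattern of a real matrix: the matrix of the signs of its entries. -/
noncomputable def signPattern {n m : ℕ} (A : Matrix (Fin n) (Fin m) ℝ) :
    Matrix (Fin n) (Fin m) SignType :=
  A.map (fun x => SignType.sign x)

/-- The qualitative class `𝒬(A)`: all real matrices with the same sign-pattern as `A`. -/
def qualClass {n m : ℕ} (A : Matrix (Fin n) (Fin m) ℝ) : Set (Matrix (Fin n) (Fin m) ℝ) :=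
  {B | signPattern B = signPattern A}

/-- The set `𝒬²ᵏ(A)` of all products `A₁ A₂ᵗ A₃ A₄ᵗ ⋯ A₂ₖ₋₁ A₂ₖᵗ` of `2k` factors with every `Aᵢ`
in `𝒬(A)`. Here `B` lists the factors `A₁, A₃, …, A₂ₖ₋₁` and `C` the factors `A₂, A₄, …, A₂ₖ`. -/
def evenQualProducts {n m : ℕ} (A : Matrix (Fin n) (Fin m) ℝ) (k : ℕ) :
    Set (Matrix (Fin n) (Fin n) ℝ) :=
  {M | ∃ B C : Fin k → Matrix (Fin n) (Fin m) ℝ,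
    (∀ i, B i ∈ qualClass A) ∧ (∀ i, C i ∈ qualClass A) ∧
      M = (List.ofFn (fun i => B i * (C i)ᵀ)).prod}

/-- The set `P₀` of real square matrices all of whose principal minors are nonnegative. (The empty
minor is `1`, so that allowing the empty index set adds no condition.) -/
def P0Matrices (n : ℕ) : Set (Matrix (Fin n) (Fin n) ℝ) :=
  {M | ∀ s : Finset (Fin n),
    0 ≤ (M.submatrix (fun i : s => (i : Fin n)) (fun i : s => (i : Fin n))).det}

/-- The set `PS` of real square matrices all of whose complex eigenvalues are real and
nonnegative. -/
def PSMatrices (n : ℕ) : Set (Matrix (Fin n) (Fin n) ℝ) :=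
  {M | ∀ z ∈ spectrum ℂ (M.map (fun x : ℝ => (x : ℂ))), ∃ r : ℝ, 0 ≤ r ∧ z = (r : ℂ)}

/-- The bipartite graph `Γ_A` of `A`: a vertex `inl i` for each row, a vertex `inr j` for each
column, and an edge between `inl i` and `inr j` exactly when `A i j ≠ 0`. -/
def bipartiteGraph {n m : ℕ} (A : Matrix (Fin n) (Fin m) ℝ) : SimpleGraph (Fin n ⊕ Fin m) where
  Adj u v := match u, v with
    | Sum.inl i, Sum.inr j => A i j ≠ 0
    | Sum.inr j, Sum.inl i => A i j ≠ 0
    | Sum.inl _, Sum.inl _ => False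
    | Sum.inr _, Sum.inr _ => False
  symm := ⟨by rintro (i | i) (j | j) h <;> exact h⟩
  loopless := ⟨by rintro (i | i) h <;> exact h⟩

/-- A leaf is a vertex with exactly one neighbour. -/
def IsLeaf {V : Type*} (G : SimpleGraph V) (v : V) : Prop := ∃! w, G.Adj v w

/-- A caterpillar is a tree which becomes a path on removal of its leaves. The path may have a
single vertex (stars, a single vertex) or no vertex (the tree with two vertices). -/
def IsCaterpillar {V : Type*} (G : SimpleGraph V) : Prop :=
  G.IsTree ∧ ∃ p : ℕ, Nonempty (G.induce {v | ¬ IsLeaf G v} ≃g SimpleGraph.pathGraph p)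

/-- A caterpillar forest is an acyclic graph each of whose connected components is a
caterpillar. -/
def IsCaterpillarForest {V : Type*} (G : SimpleGraph V) : Prop :=
  G.IsAcyclic ∧ ∀ c : G.ConnectedComponent, IsCaterpillar c.toSimpleGraph

/-!
Suppose that `Γ_A` is a caterpillar forest. A caterpillar can be drawn without crossings between two
parallel lines carrying the rows and the columns (`IsCaterpillarForest.exists_positions`). In the
resulting orders of the rows and columns, and after changing the signs of some of them, every matrix
in `𝒬(A)` and its transpose are nonnegative with noncrossing nonzero entries. Such a matrix is
*variation diminishing*: every chain of alternating signs in `B x` comes from a chain of the same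
length, with the same first sign, in `x` (`VariationDiminishing.of_noncrossing`). This property
passes to products and to principal submatrices, and it forces all eigenvalues to be real and
nonnegative, which also makes the determinant nonnegative.

* A negative eigenvalue is impossible, because an eigenvector would have maximal alternating chains
  with both first signs, and these merge into a longer one
  (`VariationDiminishing.eigenvalue_nonneg`).
* For nonreal eigenvalues, multiply the matrix by a Gaussian matrix close to the identity. A nonreal
  eigenvalue of the product gives an invariant plane on which it acts, up to scaling, by a rotation.
  By recurrence, no vector of this plane loses sign changes. The sign changes of the image of a
  vector under the Gaussian matrix produce zeros of an exponential sum; choosing a vector in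
  the plane for which this sum has one zero more, away from the sample points, contradicts Descartes'
  rule of signs for exponential sums (`exists_hasAlternation_of_expSum_eq_zero`,
  `VariationDiminishing.mul_gaussianMatrix_real`). In the limit the Gaussian matrix disappears, as
  the matrices with real spectrum form a closed set (`isClosed_complexSpectrum_subset`).

Conversely, if `Γ_A` is not a caterpillar forest, it contains a cycle or a spider with three legs of
length two (`exists_obstruction`). Since `P₀` and `PS` are closed, the factors of the products may be
degenerated by setting entries to zero. On a cycle, or on a spider, tokens can be moved along edges
so as to be permuted, in such a way that the corresponding principal minor of the product of
six factors is negative (`sign_mul_prod_nonneg`). For products of four factors, rotating all tokens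
on a cycle gives a block with trace zero that is not singular, and on a spider there is an
explicit product with nonreal eigenvalues (`exists_spider_product_eigenvalue`).
-/

/-! ### Alternating chains and variation-diminishing matrices -/

/-- `IsAltChain e k σ x i`: the indices `i 0, …, i k` are listed in increasing order of the position
function `e`, and the entries of `x` there alternate strictly in sign, the first one having the sign
of `σ`. The values of `i` beyond `k` are irrelevant. -/
def IsAltChain {ι : Type*} (e : ι → ℝ) (k : ℕ) (σ : ℝ) (x : ι → ℝ) (i : ℕ → ι) : Prop :=
  (∀ l < k, e (i l) < e (i (l + 1))) ∧ ∀ l ≤ k, 0 < (-1) ^ l * σ * x (i l)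

/-- The vector `x`, read in the order of the positions `e`, has at least `k` sign changes, along a
chain whose first entry has the sign of `σ`. -/
def HasAlternation {ι : Type*} (e : ι → ℝ) (k : ℕ) (σ : ℝ) (x : ι → ℝ) : Prop :=
  ∃ i : ℕ → ι, IsAltChain e k σ x i

/-- A matrix is variation diminishing (for given positions of its rows and columns) if every
alternation of `M x` occurs, with the same number of sign changes and the same first sign,
in `x`. -/
def VariationDiminishing {ι κ : Type*} [Fintype ι] (e : ι → ℝ) (f : κ → ℝ)
    (M : Matrix κ ι ℝ) : Prop :=
  ∀ k σ x, HasAlternation f k σ (M *ᵥ x) → HasAlternation e k σ x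

section Alternation

variable {ι κ ν : Type*} {e : ι → ℝ} {k : ℕ} {σ : ℝ} {x : ι → ℝ}

lemma IsAltChain.lt {i : ℕ → ι} (h : IsAltChain e k σ x i) {a b : ℕ} (hab : a < b) (hb : b ≤ k) :
    e (i a) < e (i b) := by
  induction b, hab using Nat.le_induction with
  | base => exact h.1 a (by omega)
  | succ b hab ih => exact (ih (by omega)).trans (h.1 b (by omega))

lemma IsAltChain.cons {i : ℕ → ι} (h : IsAltChain e k (-σ) x i) {a : ι} (ha : e a < e (i 0))
    (hx : 0 < σ * x a) : HasAlternation e (k + 1) σ x := by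
  refine ⟨fun l => Nat.casesOn l a i, ?_, ?_⟩
  · rintro (_ | l) hl
    · exact ha
    · exact h.1 l (by omega)
  · rintro (_ | l) hl
    · simpa using hx
    · have := h.2 l (by omega)
      calc (0 : ℝ) < (-1) ^ l * -σ * x (i l) := this
        _ = (-1) ^ (l + 1) * σ * x (i l) := by ring

lemma HasAlternation.lt_card [Fintype ι] (h : HasAlternation e k σ x) : k < Fintype.card ι := by
  obtain ⟨i, hi⟩ := h
  have hinj : Function.Injective (fun a : Fin (k + 1) => i a) := by
    intro a b hab
    by_contra hne
    rcases lt_or_gt_of_ne hne with hlt | hlt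
    · exact (hi.lt (a := a) (b := b) hlt (by omega)).ne (congrArg e hab)
    · exact (hi.lt (a := b) (b := a) hlt (by omega)).ne (congrArg e hab.symm)
  simpa using Fintype.card_le_of_injective _ hinj

lemma HasAlternation.smul (h : HasAlternation e k σ x) {c : ℝ} (hc : 0 < c) :
    HasAlternation e k σ (c • x) := by
  obtain ⟨i, hi⟩ := h
  refine ⟨i, hi.1, fun l hl => ?_⟩
  have := mul_pos hc (hi.2 l hl)
  simp only [Pi.smul_apply, smul_eq_mul]
  linarith

lemma HasAlternation.neg (h : HasAlternation e k σ x) : HasAlternation e k (-σ) (-x) := by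
  obtain ⟨i, hi⟩ := h
  refine ⟨i, hi.1, fun l hl => ?_⟩
  have := hi.2 l hl
  simp only [Pi.neg_apply]
  linarith

lemma exists_hasAlternation_zero (hx : x ≠ 0) : ∃ σ, HasAlternation e 0 σ x := by
  obtain ⟨i, hi⟩ := Function.ne_iff.1 hx
  refine ⟨x i, fun _ => i, by simp, fun l hl => ?_⟩
  obtain rfl : l = 0 := by omega
  simpa using mul_self_pos.2 hi

/-- A nonzero vector has a maximal number of sign changes. -/
lemma exists_max_hasAlternation [Fintype ι] (e : ι → ℝ) (hx : x ≠ 0) :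
    ∃ k, (∃ σ, HasAlternation e k σ x) ∧ ∀ σ, ¬ HasAlternation e (k + 1) σ x := by
  classical
  by_contra! hcon
  have : ∀ k, ∃ σ, HasAlternation e k σ x := by
    intro k
    induction k with
    | zero => exact exists_hasAlternation_zero hx
    | succ k ih => exact hcon k ih
  obtain ⟨σ, h⟩ := this (Fintype.card ι)
  exact h.lt_card.false

/-- Two alternating chains of the same length that start with opposite signs merge into a longer
one: put the earlier of the two first indices in front of the other chain. -/
lemma HasAlternation.merge (he : Function.Injective e) (h : HasAlternation e k σ x)
    (h' : HasAlternation e k (-σ) x) : ∃ τ, HasAlternation e (k + 1) τ x := by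
  obtain ⟨i, hi⟩ := h
  obtain ⟨j, hj⟩ := h'
  have h1 := hi.2 0 (by omega)
  have h2 := hj.2 0 (by omega)
  simp only [pow_zero, one_mul] at h1 h2
  rcases lt_trichotomy (e (i 0)) (e (j 0)) with hlt | heq | hlt
  · exact ⟨σ, hj.cons hlt h1⟩
  · rw [he heq] at h1
    linarith
  · refine ⟨-σ, IsAltChain.cons (i := i) ?_ hlt h2⟩
    rwa [neg_neg]

end Alternation

section VariationDiminishing

variable {ι κ ν : Type*} [Fintype ι] [Fintype κ] {e : ι → ℝ} {f : κ → ℝ} {g : ν → ℝ}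

lemma VariationDiminishing.mul {M : Matrix ν κ ℝ} {N : Matrix κ ι ℝ}
    (hM : VariationDiminishing f g M) (hN : VariationDiminishing e f N) :
    VariationDiminishing e g (M * N) := by
  intro k σ x h
  rw [← Matrix.mulVec_mulVec] at h
  exact hN _ _ _ (hM _ _ _ h)

lemma VariationDiminishing.one [DecidableEq ι] :
    VariationDiminishing e e (1 : Matrix ι ι ℝ) := by
  intro k σ x h
  rwa [Matrix.one_mulVec] at h

lemma VariationDiminishing.listProd [DecidableEq ι] {L : List (Matrix ι ι ℝ)}
    (h : ∀ M ∈ L, VariationDiminishing e e M) : VariationDiminishing e e L.prod := by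
  induction L with
  | nil => simpa using VariationDiminishing.one
  | cons M L ih =>
    rw [List.prod_cons]
    exact (h M (by simp)).mul (ih fun N hN => h N (by simp [hN]))

omit [Fintype κ] in
/-- A nonnegative matrix whose nonzero entries do not cross, in the sense that moving to a later row
never allows moving to an earlier column, is variation diminishing: an entry of `B x` of a given
sign comes from an entry of `x` of the same sign, and these entries appear in the same order. -/
lemma VariationDiminishing.of_noncrossing {B : Matrix κ ι ℝ} (hB : ∀ i j, 0 ≤ B i j)
    (hnc : ∀ i i' j j', B i j ≠ 0 → B i' j' ≠ 0 → j ≠ j' → f i < f i' → e j < e j') :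
    VariationDiminishing e f B := by
  rintro k σ x ⟨i, hi⟩
  have key : ∀ l, l ≤ k → ∃ j, B (i l) j ≠ 0 ∧ 0 < (-1) ^ l * σ * x j := by
    intro l hl
    have h := hi.2 l hl
    rw [Matrix.mulVec, dotProduct, Finset.mul_sum] at h
    obtain ⟨j, -, hj⟩ := Finset.exists_lt_of_sum_lt (s := Finset.univ) (f := fun _ => (0 : ℝ))
      (by simpa using h)
    have hne : B (i l) j ≠ 0 := fun h0 => by simp [h0] at hj
    have hpos : 0 < B (i l) j := lt_of_le_of_ne (hB _ _) hne.symm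
    refine ⟨j, hne, ?_⟩
    have : 0 < B (i l) j * ((-1) ^ l * σ * x j) := by linarith
    exact (mul_pos_iff_of_pos_left hpos).1 this
  have : Nonempty ι := ⟨(key 0 (by omega)).choose⟩
  choose! j hj using key
  refine ⟨j, fun l hl => ?_, fun l hl => (hj l hl).2⟩
  have h1 := hj l (by omega)
  have h2 := hj (l + 1) (by omega)
  refine hnc _ _ _ _ h1.1 h2.1 (fun heq => ?_) (hi.1 l hl)
  have h3 := h2.2
  rw [← heq, pow_succ] at h3
  have h4 := h1.2
  linarith

omit [Fintype κ] in
/-- Extension by zero outside the columns `t`, then restriction to the rows `s`, cannot create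
alternations. -/
lemma VariationDiminishing.submatrix {M : Matrix κ ι ℝ} (hM : VariationDiminishing e f M)
    {α β : Type*} [Fintype α] [Fintype β] (s : α → κ) {t : β → ι} (ht : Function.Injective t) :
    VariationDiminishing (e ∘ t) (f ∘ s) (M.submatrix s t) := by
  classical
  rintro k σ x ⟨i, hi⟩
  have hext : ∀ a, (M.submatrix s t *ᵥ x) a = (M *ᵥ Function.extend t x 0) (s a) := by
    intro a
    simp only [Matrix.mulVec, dotProduct, Matrix.submatrix_apply]
    refine (Fintype.sum_of_injective t ht _ _ (fun j hj => ?_) fun b => ?_)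
    · have hj' : ¬ ∃ b, t b = j := fun ⟨b, hb⟩ => hj ⟨b, hb⟩
      simp [Function.extend_apply' _ _ _ hj']
    · rw [ht.extend_apply]
  obtain ⟨j, hj⟩ := hM k σ (Function.extend t x 0)
    ⟨fun l => s (i l), hi.1, fun l hl => by rw [← hext]; exact hi.2 l hl⟩
  have hrange : ∀ l, l ≤ k → ∃ b, t b = j l := by
    intro l hl
    by_contra hne
    have := hj.2 l hl
    simp [Function.extend_apply' _ _ _ hne] at this
  have : Nonempty β := ⟨(hrange 0 (by omega)).choose⟩
  choose! b hb using hrange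
  refine ⟨b, fun l hl => ?_, fun l hl => ?_⟩
  · have := hj.1 l hl
    rwa [← hb l (by omega), ← hb (l + 1) (by omega)] at this
  · have := hj.2 l hl
    rwa [← hb l hl, ht.extend_apply] at this

/-- A variation-diminishing matrix has no negative real eigenvalue: a maximal alternation of an
eigenvector would also occur with the opposite first sign, and the two merge into a longer one. -/
lemma VariationDiminishing.eigenvalue_nonneg (he : Function.Injective e) {M : Matrix ι ι ℝ}
    (hM : VariationDiminishing e e M) {x : ι → ℝ} (hx : x ≠ 0) {r : ℝ} (h : M *ᵥ x = r • x) :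
    0 ≤ r := by
  by_contra! hr
  obtain ⟨k, ⟨σ, hσ⟩, hk⟩ := exists_max_hasAlternation e hx
  have h1 : HasAlternation e k (-σ) (M *ᵥ x) := by
    have := (hσ.smul (neg_pos.2 hr)).neg
    rwa [neg_smul, neg_neg, ← h] at this
  obtain ⟨τ, hτ⟩ := hσ.merge he (hM _ _ _ h1)
  exact hk τ hτ

end VariationDiminishing

/-! ### Zeros of exponential sums -/

/-- The exponential sum with exponents `e` and coefficients `b`. -/
noncomputable def expSum {ι : Type*} [Fintype ι] (e b : ι → ℝ) (u : ℝ) : ℝ :=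
  ∑ i, b i * Real.exp (e i * u)

lemma hasDerivAt_expSum {ι : Type*} [Fintype ι] (e b : ι → ℝ) (u : ℝ) :
    HasDerivAt (expSum e b) (∑ i, b i * (e i * Real.exp (e i * u))) u := by
  unfold expSum
  refine HasDerivAt.fun_sum fun i _ => HasDerivAt.const_mul _ ?_
  have := ((hasDerivAt_id u).const_mul (e i)).exp
  simpa [mul_comm] using this

lemma continuous_expSum {ι : Type*} [Fintype ι] (e b : ι → ℝ) : Continuous (expSum e b) := by
  unfold expSum
  fun_prop

/-- Rolle's theorem for `exp (-a u) * expSum e b u`: between two zeros of an exponential sum lies a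
zero of the sum with coefficients `b i * (e i - a)`. -/
lemma exists_expSum_eq_zero_between {ι : Type*} [Fintype ι] (e b : ι → ℝ) (a : ℝ) {u v : ℝ}
    (huv : u < v) (hu : expSum e b u = 0) (hv : expSum e b v = 0) :
    ∃ w, u < w ∧ w < v ∧ expSum e (fun i => b i * (e i - a)) w = 0 := by
  have hshift : ∀ w, expSum (fun i => e i - a) b w = Real.exp (-a * w) * expSum e b w := by
    intro w
    rw [expSum, expSum, Finset.mul_sum]
    refine Finset.sum_congr rfl fun i _ => ?_
    rw [sub_mul, sub_eq_add_neg, ← neg_mul, Real.exp_add]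
    ring
  obtain ⟨w, ⟨h1, h2⟩, h3⟩ := exists_hasDerivAt_eq_zero (f := expSum (fun i => e i - a) b) huv
    (continuous_expSum _ _).continuousOn (by rw [hshift, hshift, hu, hv, mul_zero, mul_zero])
    (fun w _ => hasDerivAt_expSum _ _ w)
  refine ⟨w, h1, h2, ?_⟩
  have h4 : Real.exp (-a * w) * expSum e (fun i => b i * (e i - a)) w = 0 := by
    rw [← h3, expSum, Finset.mul_sum]
    refine Finset.sum_congr rfl fun i _ => ?_
    rw [sub_mul (e i) a w, sub_eq_add_neg (e i * w), ← neg_mul, Real.exp_add]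
    ring
  exact (mul_eq_zero.1 h4).resolve_left (Real.exp_ne_zero _)

/-- Descartes' rule of signs for exponential sums: if the sum has `k` zeros, its coefficients, in
the order of the exponents, have at least `k` sign changes. -/
lemma exists_hasAlternation_of_expSum_eq_zero {ι : Type*} [Fintype ι] {e : ι → ℝ}
    (he : Function.Injective e) (k : ℕ) :
    ∀ {b : ι → ℝ}, b ≠ 0 → ∀ z : ℕ → ℝ, (∀ l, l + 1 < k → z l < z (l + 1)) →
      (∀ l < k, expSum e b (z l) = 0) → ∃ σ, HasAlternation e k σ b := by
  classical
  induction k with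
  | zero => exact fun hb _ _ _ => exists_hasAlternation_zero hb
  | succ k ih =>
    intro b hb z hz hroot
    obtain ⟨i₀, hi₀⟩ := Function.ne_iff.1 hb
    -- `p` is the first index of a nonzero coefficient, `q` the first one of opposite sign
    obtain ⟨p, hp, hpmin⟩ := Finset.exists_min_image (Finset.univ.filter fun i => b i ≠ 0) e
      ⟨i₀, by simpa using hi₀⟩
    simp only [Finset.mem_filter, Finset.mem_univ, true_and] at hp hpmin
    have hopp : (Finset.univ.filter fun i => b p * b i < 0).Nonempty := by
      by_contra hne
      rw [Finset.not_nonempty_iff_eq_empty, Finset.filter_eq_empty_iff] at hne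
      have hpos : 0 < ∑ i, b p * b i * Real.exp (e i * z 0) := by
        refine Finset.sum_pos' (fun i hi => ?_) ⟨p, Finset.mem_univ _, ?_⟩
        · exact mul_nonneg (not_lt.1 (hne hi)) (Real.exp_pos _).le
        · exact mul_pos (mul_self_pos.2 hp) (Real.exp_pos _)
      have h0 := hroot 0 (by omega)
      simp only [mul_assoc, ← Finset.mul_sum] at hpos
      rw [expSum] at h0
      simp [h0] at hpos
    obtain ⟨q, hq, hqmin⟩ := Finset.exists_min_image _ e hopp
    simp only [Finset.mem_filter, Finset.mem_univ, true_and] at hq hqmin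
    have hpq : e p < e q := by
      refine lt_of_le_of_ne (hpmin q fun h => by simp [h] at hq) fun h => ?_
      rw [← he h] at hq
      exact absurd hq (not_lt.2 (mul_self_nonneg _))
    set b' : ι → ℝ := fun i => b i * (e i - e q) with hb'
    have hb'0 : b' ≠ 0 := fun h => by
      have := congrFun h p
      simp only [hb', Pi.zero_apply, mul_eq_zero] at this
      rcases this with h | h
      · exact hp h
      · linarith
    have hrolle : ∀ l, ∃ w, l < k → z l < w ∧ w < z (l + 1) ∧ expSum e b' w = 0 := by
      intro l
      by_cases hl : l < k
      · obtain ⟨w, hw⟩ := exists_expSum_eq_zero_between e b (e q) (hz l (by omega))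
          (hroot l (by omega)) (hroot (l + 1) (by omega))
        exact ⟨w, fun _ => hw⟩
      · exact ⟨0, fun h => absurd h hl⟩
    choose w hw using hrolle
    obtain ⟨σ, i, hi⟩ := ih hb'0 w
      (fun l hl => (hw l (by omega)).2.1.trans (hw (l + 1) (by omega)).1)
      (fun l hl => (hw l hl).2.2)
    -- beyond `q` the signs of `b'` and `b` agree; before `q`, the entries of `b` have the sign
    -- of `b p` and those of `b'` the opposite sign
    have hafter : ∀ l ≤ k, e q < e (i l) → 0 < (-1) ^ l * σ * b (i l) := by
      intro l hl hlt
      have := hi.2 l hl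
      simp only [hb', ← mul_assoc] at this
      exact (mul_pos_iff_of_pos_right (sub_pos.2 hlt)).1 this
    have hne : ∀ l ≤ k, e (i l) ≠ e q := by
      intro l hl h
      have := hi.2 l hl
      simp [hb', h] at this
    have hbefore : ∀ j, e j < e q → 0 ≤ b p * b j := fun j hj => by
      by_contra! h
      exact absurd (hqmin j h) (not_le.2 hj)
    have hneg : ∀ l ≤ k, e (i l) < e q → (-1) ^ l * σ * b p < 0 := by
      intro l hl hlt
      have h1 := hi.2 l hl
      have h2 := hbefore _ hlt
      simp only [hb', ← mul_assoc] at h1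
      have h3 : (-1) ^ l * σ * b (i l) < 0 := by
        by_contra! h
        exact absurd h1 (not_lt.2 (mul_nonpos_of_nonneg_of_nonpos h (by linarith)))
      rcases lt_or_gt_of_ne hp with hp' | hp'
      · have : b (i l) ≤ 0 := by nlinarith
        nlinarith
      · have : 0 ≤ b (i l) := by nlinarith
        nlinarith
    rcases lt_or_gt_of_ne (hne 0 (by omega)) with h0 | h0
    · -- the chain starts before `q`: insert `q` after its first index
      have hs := hneg 0 (by omega) h0
      have hb0 : 0 < -σ * b (i 0) := by
        have h1 := hi.2 0 (by omega)
        simp only [hb', pow_zero, one_mul, ← mul_assoc] at h1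
        nlinarith
      have hq' : 0 < σ * b q := by
        simp only [pow_zero, one_mul] at hs
        rcases lt_or_gt_of_ne hp with hp' | hp'
        · exact mul_pos (by nlinarith) (by nlinarith)
        · exact mul_pos_of_neg_of_neg (by nlinarith) (by nlinarith)
      have hrest : ∀ l, 1 ≤ l → l ≤ k → e q < e (i l) := by
        intro l h1 hl
        have hstep : e q < e (i 1) := by
          refine lt_of_le_of_ne (not_lt.1 fun hlt => ?_) (hne 1 (by omega)).symm
          have := hneg 1 (by omega) hlt
          simp only [pow_zero, one_mul, pow_one] at this hs
          linarith
        rcases h1.eq_or_lt with rfl | h1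
        · exact hstep
        · exact hstep.trans (hi.lt h1 hl)
      have hchain : IsAltChain e k σ b (fun l => Nat.casesOn l q fun l => i (l + 1)) := by
        refine ⟨?_, ?_⟩
        · rintro (_ | l) hl
          · exact hrest 1 le_rfl (by omega)
          · exact hi.1 (l + 1) (by omega)
        · rintro (_ | l) hl
          · simpa using hq'
          · exact hafter (l + 1) hl (hrest (l + 1) (by omega) hl)
      refine ⟨-σ, IsAltChain.cons (i := fun l => Nat.casesOn l q fun l => i (l + 1)) ?_ h0 hb0⟩
      rwa [neg_neg]
    · -- the chain lies beyond `q`: put `p` or `q` in front of it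
      have hchain : IsAltChain e k σ b i := by
        refine ⟨hi.1, fun l hl => hafter l hl ?_⟩
        rcases l.eq_zero_or_pos with rfl | hpos
        · exact h0
        · exact h0.trans (hi.lt hpos hl)
      have hσ : σ ≠ 0 := by
        rintro rfl
        simpa using hi.2 0 (by omega)
      rcases lt_trichotomy (-σ * b p) 0 with hlt | heq | hgt
      · refine ⟨-σ, IsAltChain.cons (i := i) (by rwa [neg_neg]) h0 ?_⟩
        have := mul_pos_of_neg_of_neg hlt hq
        exact (mul_pos_iff_of_pos_left (mul_self_pos.2 hp)).1 (by linarith)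
      · simp [hσ, hp] at heq
      · exact ⟨-σ, IsAltChain.cons (i := i) (by rwa [neg_neg]) (hpq.trans h0) hgt⟩

/-! ### The spectrum of a variation-diminishing matrix -/

/-- The complex spectrum of a real square matrix. -/
def complexSpectrum {ι : Type*} [Fintype ι] [DecidableEq ι] (M : Matrix ι ι ℝ) : Set ℂ :=
  spectrum ℂ (M.map (fun x : ℝ => (x : ℂ)))

/-- The half-line of nonnegative real numbers in `ℂ`. -/
def nonnegRealLine : Set ℂ := {z | ∃ r : ℝ, 0 ≤ r ∧ z = (r : ℂ)}

section Spectrum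

variable {ι : Type*} [Fintype ι] [DecidableEq ι]

lemma mem_complexSpectrum_iff_det {M : Matrix ι ι ℝ} {z : ℂ} :
    z ∈ complexSpectrum M ↔
      (Matrix.scalar ι z - M.map (fun x : ℝ => (x : ℂ))).det = 0 := by
  rw [complexSpectrum, Matrix.mem_spectrum_iff_isRoot_charpoly, Polynomial.IsRoot.def,
    Matrix.eval_charpoly]

lemma mem_complexSpectrum_iff_exists {M : Matrix ι ι ℝ} {z : ℂ} :
    z ∈ complexSpectrum M ↔
      ∃ v : ι → ℂ, v ≠ 0 ∧ M.map (fun x : ℝ => (x : ℂ)) *ᵥ v = z • v := by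
  rw [mem_complexSpectrum_iff_det, ← Matrix.exists_mulVec_eq_zero_iff]
  refine exists_congr fun v => and_congr_right fun _ => ?_
  rw [Matrix.sub_mulVec, sub_eq_zero, eq_comm, Matrix.scalar_apply,
    ← Matrix.smul_one_eq_diagonal, Matrix.smul_mulVec, Matrix.one_mulVec]

/-- The eigenvalues depend continuously on the matrix, in the sense that the matrices with all
eigenvalues in a closed set form a closed set: if all eigenvalues of `N` keep the distance `r` from
`z`, then `|det (z - N)| ≥ r ^ card ι`. -/
lemma isClosed_complexSpectrum_subset {K : Set ℂ} (hK : IsClosed K) :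
    IsClosed {M : Matrix ι ι ℝ | complexSpectrum M ⊆ K} := by
  rw [← isOpen_compl_iff, isOpen_iff_mem_nhds]
  intro M hM
  simp only [Set.mem_compl_iff, Set.mem_ofPred_eq, Set.not_subset] at hM
  obtain ⟨z, hz, hzK⟩ := hM
  obtain ⟨r, hr, hball⟩ := Metric.isOpen_iff.1 hK.isOpen_compl z hzK
  have hcont : Continuous fun N : Matrix ι ι ℝ =>
      ‖(Matrix.scalar ι z - N.map (fun x : ℝ => (x : ℂ))).det‖ := by
    refine continuous_norm.comp (Continuous.matrix_det ?_)
    exact continuous_const.sub (continuous_id.matrix_map Complex.continuous_ofReal)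
  have hlt : ‖(Matrix.scalar ι z - M.map (fun x : ℝ => (x : ℂ))).det‖ < r ^ Fintype.card ι := by
    rw [mem_complexSpectrum_iff_det.1 hz, norm_zero]
    positivity
  filter_upwards [hcont.continuousAt.eventually_lt continuousAt_const hlt] with N hN hNK
  refine absurd hN (not_lt.2 ?_)
  set P := N.map (fun x : ℝ => (x : ℂ)) with hP
  rw [← Matrix.eval_charpoly, (IsAlgClosed.splits P.charpoly).eval_eq_prod_roots_of_monic
    P.charpoly_monic]
  have hcard : P.charpoly.roots.card = Fintype.card ι := by
    rw [← Matrix.charpoly_natDegree_eq_dim P]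
    exact (Polynomial.splits_iff_card_roots.1 (IsAlgClosed.splits P.charpoly))
  rw [← hcard]
  have hroot : ∀ a ∈ P.charpoly.roots, r ≤ ‖z - a‖ := by
    intro a ha
    by_contra! h
    have haK : a ∈ K := hNK (Matrix.mem_spectrum_iff_isRoot_charpoly.2
      (Polynomial.isRoot_of_mem_roots ha))
    exact hball (by rwa [Metric.mem_ball, dist_comm, dist_eq_norm]) haK
  generalize P.charpoly.roots = S at hroot
  induction S using Multiset.induction_on with
  | empty => simp
  | cons a S ih =>
    rw [Multiset.map_cons, Multiset.prod_cons, norm_mul, Multiset.card_cons, pow_succ']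
    exact mul_le_mul (hroot a (by simp)) (ih fun b hb => hroot b (by simp [hb])) (by positivity)
      (norm_nonneg _)

lemma isClosed_nonnegRealLine : IsClosed nonnegRealLine := by
  have : nonnegRealLine = (fun r : ℝ => (r : ℂ)) '' Set.Ici 0 := by
    ext z
    simp [nonnegRealLine, eq_comm]
  rw [this]
  exact Complex.isometry_ofReal.isClosedEmbedding.isClosedMap _ isClosed_Ici

lemma isClosed_PSMatrices (n : ℕ) : IsClosed (PSMatrices n) :=
  isClosed_complexSpectrum_subset isClosed_nonnegRealLine

lemma isClosed_P0Matrices (n : ℕ) : IsClosed (P0Matrices n) := by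
  simp only [P0Matrices, Set.ofPred_forall]
  refine isClosed_iInter fun s => isClosed_le continuous_const (Continuous.matrix_det ?_)
  exact continuous_id.matrix_submatrix _ _

/-- The determinant is the product of the eigenvalues. -/
lemma det_nonneg_of_complexSpectrum_subset {M : Matrix ι ι ℝ}
    (hM : complexSpectrum M ⊆ nonnegRealLine) : 0 ≤ M.det := by
  have hroot : ∀ a ∈ (M.map (fun x : ℝ => (x : ℂ))).charpoly.roots, a ∈ nonnegRealLine :=
    fun a ha => hM (Matrix.mem_spectrum_iff_isRoot_charpoly.2 (Polynomial.isRoot_of_mem_roots ha))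
  have hprod : (M.map (fun x : ℝ => (x : ℂ))).charpoly.roots.prod ∈ nonnegRealLine := by
    refine Multiset.prod_induction _ _ ?_ ⟨1, zero_le_one, by simp⟩ hroot
    rintro _ _ ⟨a, ha, rfl⟩ ⟨b, hb, rfl⟩
    exact ⟨a * b, mul_nonneg ha hb, by simp⟩
  rw [← Matrix.det_eq_prod_roots_charpoly] at hprod
  obtain ⟨r, hr, h⟩ := hprod
  have hdet : (M.map (fun x : ℝ => (x : ℂ))).det = (M.det : ℂ) :=
    (RingHom.map_det Complex.ofRealHom M).symm
  rw [hdet, Complex.ofReal_inj] at h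
  rwa [h]

/-- If all eigenvalues are nonnegative reals and the trace, their sum, is zero, then they are all
zero, and so is their product. -/
lemma det_eq_zero_of_trace_eq_zero [Nonempty ι] {M : Matrix ι ι ℝ}
    (hM : complexSpectrum M ⊆ nonnegRealLine) (htr : M.trace = 0) : M.det = 0 := by
  set P := M.map (fun x : ℝ => (x : ℂ)) with hP
  have hroot : ∀ a ∈ P.charpoly.roots, a ∈ nonnegRealLine :=
    fun a ha => hM (Matrix.mem_spectrum_iff_isRoot_charpoly.2 (Polynomial.isRoot_of_mem_roots ha))
  have hsum : P.charpoly.roots.sum = 0 := by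
    rw [← Matrix.trace_eq_sum_roots_charpoly]
    have : P.trace = (M.trace : ℂ) := by simp [hP, Matrix.trace]
    rw [this, htr, Complex.ofReal_zero]
  have hdet : P.det = (M.det : ℂ) := (RingHom.map_det Complex.ofRealHom M).symm
  have hcard : P.charpoly.roots.card = Fintype.card ι := by
    rw [← Matrix.charpoly_natDegree_eq_dim P]
    exact (Polynomial.splits_iff_card_roots.1 (IsAlgClosed.splits P.charpoly))
  obtain ⟨a, ha⟩ := Multiset.card_pos_iff_exists_mem.1 (hcard ▸ Fintype.card_pos (α := ι))
  have hre : (P.charpoly.roots.map Complex.re).sum = 0 := by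
    have := congrArg Complex.reAddGroupHom hsum
    rwa [map_multiset_sum, map_zero] at this
  have hnonneg : ∀ b ∈ P.charpoly.roots.map Complex.re, 0 ≤ b := by
    intro b hb
    obtain ⟨c, hc, rfl⟩ := Multiset.mem_map.1 hb
    obtain ⟨r, hr, rfl⟩ := hroot c hc
    simpa using hr
  have ha0 : a = 0 := by
    have h1 := Multiset.all_zero_of_le_zero_le_of_sum_eq_zero hnonneg hre a.re
      (Multiset.mem_map_of_mem Complex.re ha)
    obtain ⟨r, hr, rfl⟩ := hroot a ha
    simpa using h1
  have := Multiset.prod_eq_zero (ha0 ▸ ha)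
  rw [← Matrix.det_eq_prod_roots_charpoly, hdet] at this
  exact_mod_cast this

end Spectrum

section Gaussian

variable {ι : Type*} [Fintype ι] {e : ι → ℝ}

/-- The Gaussian matrix `exp (-β (eᵢ - eⱼ)²)`. It tends to the identity as `β → ∞`; up to diagonal
factors, it evaluates exponential sums at the points `2 β eᵢ`. -/
noncomputable def gaussianMatrix (e : ι → ℝ) (β : ℝ) : Matrix ι ι ℝ :=
  Matrix.of fun i j => Real.exp (-β * (e i - e j) ^ 2)

lemma gaussianMatrix_mulVec (e : ι → ℝ) (β : ℝ) (x : ι → ℝ) (i : ι) :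
    (gaussianMatrix e β *ᵥ x) i = Real.exp (-β * e i ^ 2) *
      expSum e (fun j => Real.exp (-β * e j ^ 2) * x j) (2 * β * e i) := by
  simp only [gaussianMatrix, Matrix.mulVec, dotProduct, Matrix.of_apply, expSum, Finset.mul_sum]
  refine Finset.sum_congr rfl fun j _ => ?_
  have : -β * (e i - e j) ^ 2 = -β * e i ^ 2 + (-β * e j ^ 2 + e j * (2 * β * e i)) := by ring
  rw [this, Real.exp_add, Real.exp_add]
  ring

omit [Fintype ι] in
lemma tendsto_gaussianMatrix [DecidableEq ι] (he : Function.Injective e) :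
    Filter.Tendsto (gaussianMatrix e) Filter.atTop (nhds 1) := by
  refine tendsto_pi_nhds.2 fun i => tendsto_pi_nhds.2 fun j => ?_
  by_cases hij : i = j
  · subst hij
    simp [gaussianMatrix]
  · simp only [gaussianMatrix, Matrix.of_apply, Matrix.one_apply_ne hij]
    refine Real.tendsto_exp_atBot.comp ?_
    have : 0 < (e i - e j) ^ 2 := by
      have := sub_ne_zero.2 (he.ne hij)
      positivity
    exact Filter.tendsto_neg_atTop_atBot.atBot_mul_const this

/-- The sign changes of `gaussianMatrix e β *ᵥ x` produce zeros of an exponential sum, beyond the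
sample point of the first index of the chain. -/
lemma IsAltChain.exists_expSum_zeros {β : ℝ} (hβ : 0 < β) {k : ℕ} {σ : ℝ} {x : ι → ℝ} {i : ℕ → ι}
    (h : IsAltChain e k σ (gaussianMatrix e β *ᵥ x) i) :
    ∃ z : ℕ → ℝ, (∀ l, l + 1 < k → z l < z (l + 1)) ∧ ∀ l < k, 2 * β * e (i l) < z l ∧
      expSum e (fun j => Real.exp (-β * e j ^ 2) * x j) (z l) = 0 := by
  set F := expSum e (fun j => Real.exp (-β * e j ^ 2) * x j) with hF
  have hsign : ∀ l ≤ k, 0 < (-1) ^ l * σ * F (2 * β * e (i l)) := by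
    intro l hl
    have := h.2 l hl
    rw [gaussianMatrix_mulVec, mul_left_comm] at this
    exact (mul_pos_iff_of_pos_left (Real.exp_pos _)).1 this
  have hex : ∀ l, ∃ z, l < k → 2 * β * e (i l) < z ∧ z < 2 * β * e (i (l + 1)) ∧ F z = 0 := by
    intro l
    by_cases hl : l < k
    swap
    · exact ⟨0, fun h => absurd h hl⟩
    have h1 := hsign l hl.le
    have h2 := hsign (l + 1) hl
    have hlt : 2 * β * e (i l) < 2 * β * e (i (l + 1)) :=
      mul_lt_mul_of_pos_left (h.1 l hl) (by linarith)
    have hcont : ContinuousOn (fun u => (-1) ^ l * σ * F u)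
        (Set.Icc (2 * β * e (i l)) (2 * β * e (i (l + 1)))) :=
      (continuous_const.mul (continuous_expSum _ _)).continuousOn
    obtain ⟨z, hz, hz0⟩ := intermediate_value_Ioo' hlt.le hcont
      (show (0 : ℝ) ∈ Set.Ioo _ _ from ⟨by rw [pow_succ] at h2; linarith, h1⟩)
    refine ⟨z, fun _ => ⟨hz.1, hz.2, (mul_eq_zero.1 hz0).resolve_left fun h0 => ?_⟩⟩
    rw [h0] at h1
    simp at h1
  choose z hz using hex
  exact ⟨z, fun l hl => (hz l (by omega)).2.1.trans (hz (l + 1) hl).1,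
    fun l hl => ⟨(hz l hl).1, (hz l hl).2.2⟩⟩

lemma exists_hasAlternation_of_gaussianMatrix (he : Function.Injective e) {β : ℝ} (hβ : 0 < β)
    {k : ℕ} {σ : ℝ} {x : ι → ℝ} (h : HasAlternation e k σ (gaussianMatrix e β *ᵥ x)) :
    ∃ τ, HasAlternation e k τ x := by
  obtain ⟨i, hi⟩ := h
  obtain ⟨z, hz, hroot⟩ := hi.exists_expSum_zeros hβ
  have hx : (fun j => Real.exp (-β * e j ^ 2) * x j) ≠ 0 := by
    intro h0
    have := hi.2 0 (by omega)
    rw [gaussianMatrix_mulVec, h0] at this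
    simp [expSum] at this
  obtain ⟨τ, j, hj⟩ := exists_hasAlternation_of_expSum_eq_zero he k hx z hz
    fun l hl => (hroot l hl).2
  refine ⟨τ, j, hj.1, fun l hl => ?_⟩
  have := hj.2 l hl
  rw [mul_left_comm] at this
  exact (mul_pos_iff_of_pos_left (Real.exp_pos _)).1 this

/-- The powers of a complex number of modulus one return to every neighbourhood of `1`. -/
lemma exists_pow_mem_of_norm_eq_one {u : ℂ} (hu : ‖u‖ = 1) {U : Set ℂ} (hU : U ∈ nhds 1) :
    ∃ q : ℕ, u ^ (q + 1) ∈ U := by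
  set c : Circle := ⟨u, by simpa [Submonoid.unitSphere] using hu⟩ with hc
  have h1 : (fun w : Circle => (w : ℂ)) ⁻¹' U ∈ nhds (1 : Circle) :=
    continuous_subtype_val.continuousAt.preimage_mem_nhds (by simpa using hU)
  have h2 := (mapClusterPt_one_atTop_pow c).frequently h1
  obtain ⟨q, hq, hmem⟩ := (Filter.frequently_atTop.1 h2) 1
  obtain ⟨p, rfl⟩ : ∃ p, q = p + 1 := ⟨q - 1, by omega⟩
  refine ⟨p, ?_⟩
  have : ((c ^ (p + 1) : Circle) : ℂ) = u ^ (p + 1) := by rw [Circle.coe_pow]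
  rw [← this]
  exact hmem

/-- If `M` is variation diminishing, all eigenvalues of `M * gaussianMatrix e β` are real.

Suppose `v` is an eigenvector to a nonreal eigenvalue `μ`. The product acts on the real plane
of the vectors `Re (c v)`, `c : ℂ`, as a rotation combined with a scaling, so that orbits return, up
to scaling, arbitrarily close to their start. Since sign changes are stable under small
perturbations and never increase along an orbit, every vector of the plane has as many sign changes
as its image under the Gaussian matrix. But the plane contains a nonzero vector whose exponential
sum vanishes at a prescribed point, here one to the left of all sample points; by Descartes' rule of
signs this vector has more sign changes than its image. -/
lemma VariationDiminishing.mul_gaussianMatrix_real [DecidableEq ι] (he : Function.Injective e)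
    {M : Matrix ι ι ℝ} (hM : VariationDiminishing e e M) {β : ℝ} (hβ : 0 < β) :
    complexSpectrum (M * gaussianMatrix e β) ⊆ {z | z.im = 0} := by
  intro μ hμ
  obtain ⟨v, hv0, hv⟩ := mem_complexSpectrum_iff_exists.1 hμ
  by_contra him
  simp only [Set.mem_ofPred_eq] at him
  set T := gaussianMatrix e β with hT
  set X : ℂ → ι → ℝ := fun c i => (c * v i).re with hX
  have hstep : ∀ c, (M * T) *ᵥ X c = X (μ * c) := by
    intro c
    funext i
    have hi := congrArg (fun w => (c * w).re) (congrFun hv i)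
    simp only [Pi.smul_apply, smul_eq_mul] at hi
    simp only [hX]
    rw [show μ * c * v i = c * (μ * v i) by ring, ← hi]
    simp only [Matrix.mulVec, dotProduct, Matrix.map_apply, Finset.mul_sum, Complex.re_sum]
    refine Finset.sum_congr rfl fun j _ => ?_
    rw [mul_left_comm c, Complex.re_ofReal_mul]
  have hX0 : ∀ c, c ≠ 0 → X c ≠ 0 := by
    intro c hc h0
    obtain ⟨i, hi⟩ := Function.ne_iff.1 hv0
    have h1 : (c * v i).re = 0 := congrFun h0 i
    have h2 : (μ * c * v i).re = 0 := by
      have := congrFun (hstep c) i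
      rw [h0, Matrix.mulVec_zero] at this
      exact this.symm
    rw [mul_assoc, Complex.mul_re, h1, mul_zero, zero_sub, neg_eq_zero] at h2
    exact mul_ne_zero hc hi (Complex.ext h1 ((mul_eq_zero.1 h2).resolve_left him))
  have hμ0 : μ ≠ 0 := fun h => him (by simp [h])
  have hpeel : ∀ k q σ c, HasAlternation e k σ (X (μ ^ (q + 1) * c)) →
      ∃ τ, HasAlternation e k τ (T *ᵥ X c) := by
    intro k q
    induction q with
    | zero =>
      intro σ c h
      rw [zero_add, pow_one, ← hstep, ← Matrix.mulVec_mulVec] at h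
      exact ⟨σ, hM _ _ _ h⟩
    | succ q ih =>
      intro σ c h
      rw [pow_succ', mul_assoc, ← hstep, ← Matrix.mulVec_mulVec] at h
      obtain ⟨τ, hτ⟩ := exists_hasAlternation_of_gaussianMatrix he hβ (hM _ _ _ h)
      exact ih τ c hτ
  have hreturn : ∀ k σ c, HasAlternation e k σ (X c) →
      ∃ τ, HasAlternation e k τ (T *ᵥ X c) := by
    rintro k σ c ⟨i, hi⟩
    have hopen : ∀ᶠ w in nhds (1 : ℂ), ∀ l ∈ Finset.range (k + 1),
        0 < (-1) ^ l * σ * X (w * c) (i l) := by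
      rw [Filter.eventually_all_finset]
      intro l hl
      have hcont : Continuous fun w : ℂ => (-1) ^ l * σ * X (w * c) (i l) := by
        simp only [hX]
        fun_prop
      refine hcont.continuousAt.eventually (lt_mem_nhds ?_)
      have := hi.2 l (by simpa [Nat.lt_succ_iff] using hl)
      simpa only [one_mul] using this
    obtain ⟨q, hq⟩ := exists_pow_mem_of_norm_eq_one (u := μ / ‖μ‖) (by simp [hμ0]) hopen
    have h1 : HasAlternation e k σ (X ((μ / ‖μ‖) ^ (q + 1) * c)) :=
      ⟨i, hi.1, fun l hl => hq l (by simpa [Nat.lt_succ_iff] using hl)⟩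
    have h2 : X (μ ^ (q + 1) * c) = (‖μ‖ ^ (q + 1)) • X ((μ / ‖μ‖) ^ (q + 1) * c) := by
      funext j
      simp only [hX, Pi.smul_apply, smul_eq_mul]
      rw [← Complex.re_ofReal_mul]
      congr 1
      have : (‖μ‖ : ℂ) ≠ 0 := by simpa using hμ0
      rw [div_pow]
      push_cast
      field_simp
    have h3 : HasAlternation e k σ (X (μ ^ (q + 1) * c)) := by
      rw [h2]
      exact h1.smul (pow_pos (norm_pos_iff.2 hμ0) _)
    exact hpeel k q σ c h3
  -- a point to the left of all sample points, and a vector whose exponential sum vanishes there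
  obtain ⟨u, hu⟩ : ∃ u : ℝ, ∀ i, u < 2 * β * e i := by
    obtain ⟨B, hB⟩ := (Set.finite_range fun i => 2 * β * e i).bddBelow
    exact ⟨B - 1, fun i => by linarith [hB ⟨i, rfl⟩]⟩
  obtain ⟨c, hc, hcu⟩ : ∃ c : ℂ, c ≠ 0 ∧
      expSum e (fun j => Real.exp (-β * e j ^ 2) * X c j) u = 0 := by
    set S : ℂ := ∑ j, ((Real.exp (-β * e j ^ 2) * Real.exp (e j * u) : ℝ) : ℂ) * v j with hS
    have hval : ∀ c : ℂ, expSum e (fun j => Real.exp (-β * e j ^ 2) * X c j) u = (c * S).re := by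
      intro c
      simp only [expSum, hS, hX, Finset.mul_sum, Complex.re_sum]
      refine Finset.sum_congr rfl fun j _ => ?_
      rw [mul_left_comm c, Complex.re_ofReal_mul]
      ring
    by_cases hS0 : S = 0
    · exact ⟨1, one_ne_zero, by rw [hval, hS0, mul_zero, Complex.zero_re]⟩
    · refine ⟨Complex.I * (starRingEnd ℂ) S, by simp [hS0], ?_⟩
      rw [hval, mul_assoc, mul_comm _ S, Complex.mul_conj]
      simp
  obtain ⟨k, ⟨σ, hσ⟩, hk⟩ := exists_max_hasAlternation e (hX0 c hc)
  obtain ⟨τ, i, hi⟩ := hreturn k σ c hσ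
  obtain ⟨z, hz, hroot⟩ := hi.exists_expSum_zeros hβ
  obtain ⟨ρ, j, hj⟩ := exists_hasAlternation_of_expSum_eq_zero he (k + 1)
    (b := fun j => Real.exp (-β * e j ^ 2) * X c j)
    (fun h => hX0 c hc (funext fun j => by simpa using congrFun h j))
    (fun l => Nat.casesOn l u z)
    (by
      rintro (_ | l) hl
      · exact (hu _).trans (hroot 0 (by omega)).1
      · exact hz l (by omega))
    (by
      rintro (_ | l) hl
      · exact hcu
      · exact (hroot l (by omega)).2)
  refine hk ρ ⟨j, hj.1, fun l hl => ?_⟩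
  have := hj.2 l hl
  rw [mul_left_comm] at this
  exact (mul_pos_iff_of_pos_left (Real.exp_pos _)).1 this

/-- All eigenvalues of a variation-diminishing matrix are real and nonnegative. -/
theorem VariationDiminishing.complexSpectrum_subset [DecidableEq ι] (he : Function.Injective e)
    {M : Matrix ι ι ℝ} (hM : VariationDiminishing e e M) :
    complexSpectrum M ⊆ nonnegRealLine := by
  have hreal : complexSpectrum M ⊆ {z | z.im = 0} := by
    have hclosed := isClosed_complexSpectrum_subset (ι := ι)
      (isClosed_eq Complex.continuous_im continuous_const : IsClosed {z : ℂ | z.im = 0})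
    have hlim : Filter.Tendsto (fun β => M * gaussianMatrix e β) Filter.atTop (nhds (M * 1)) :=
      ((continuous_const.matrix_mul continuous_id).tendsto 1).comp (tendsto_gaussianMatrix he)
    rw [mul_one] at hlim
    refine hclosed.mem_of_tendsto hlim ?_
    filter_upwards [Filter.eventually_gt_atTop 0] with β hβ
    exact hM.mul_gaussianMatrix_real he hβ
  intro z hz
  have hzim : z.im = 0 := hreal hz
  have hzre : z = (z.re : ℂ) := Complex.ext rfl (by simpa using hzim)
  refine ⟨z.re, ?_, hzre⟩
  have hdet : (Matrix.scalar ι z.re - M).det = 0 := by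
    have h := mem_complexSpectrum_iff_det.1 hz
    have h2 : Matrix.scalar ι z - M.map (fun x : ℝ => (x : ℂ)) =
        (Complex.ofRealHom.mapMatrix) (Matrix.scalar ι z.re - M) := by
      ext i j
      by_cases hij : i = j
      · subst hij
        simp [← hzre]
      · simp [hij]
    rw [h2, ← RingHom.map_det] at h
    exact Complex.ofReal_eq_zero.1 h
  obtain ⟨x, hx, hx0⟩ := Matrix.exists_mulVec_eq_zero_iff.2 hdet
  refine hM.eigenvalue_nonneg he hx ?_
  rw [Matrix.sub_mulVec, sub_eq_zero, Matrix.scalar_apply, ← Matrix.smul_one_eq_diagonal,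
    Matrix.smul_mulVec, Matrix.one_mulVec] at hx0
  exact hx0.symm

/-- All principal minors of a variation-diminishing matrix are nonnegative, because its principal
submatrices are variation diminishing again. -/
lemma VariationDiminishing.principalMinor_nonneg [DecidableEq ι] (he : Function.Injective e)
    {M : Matrix ι ι ℝ} (hM : VariationDiminishing e e M) (s : Finset ι) :
    0 ≤ (M.submatrix (fun i : s => (i : ι)) (fun i : s => (i : ι))).det :=
  det_nonneg_of_complexSpectrum_subset
    ((hM.submatrix (fun i : s => (i : ι)) Subtype.val_injective).complexSpectrum_subset
      (he.comp Subtype.val_injective))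

end Gaussian

/-! ### Layouts of caterpillar forests -/

/-- Two adjacent leaves of a connected graph are its only vertices. -/
lemma eq_or_eq_of_adj_leaves {V : Type*} {G : SimpleGraph V} (hG : G.Connected) {a b : V}
    (hab : G.Adj a b) (ha : IsLeaf G a) (hb : IsLeaf G b) (v : V) : v = a ∨ v = b := by
  obtain ⟨w⟩ := hG.preconnected v a
  induction w with
  | nil => exact Or.inl rfl
  | cons h _ ih =>
    rcases ih hab ha with rfl | rfl
    · exact Or.inr (ha.unique h.symm hab)
    · exact Or.inl (hb.unique h.symm hab.symm)

/-- A caterpillar can be drawn without crossings between two parallel lines that carry its two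
colour classes, and edge signs on it are products of vertex signs. The position `κ v` of a vertex
is its number on the spine, that of a leaf is the number of its neighbour; the signs are
accumulated along the spine. -/
lemma IsCaterpillar.exists_layout {V : Type*} {G : SimpleGraph V} (hG : IsCaterpillar G)
    (side : V → Bool) (hside : ∀ u v, G.Adj u v → side u ≠ side v)
    (s : V → V → ℝ) (hsymm : ∀ u v, s u v = s v u) (hs : ∀ u v, G.Adj u v → s u v * s u v = 1) :
    ∃ (κ : V → ℕ) (ε : V → ℝ), (∀ v, ε v * ε v = 1) ∧ (∀ u v, G.Adj u v → s u v = ε u * ε v) ∧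
      ∀ u v u' v', G.Adj u v → G.Adj u' v' → side u = side u' → u ≠ u' → v ≠ v' →
        κ u ≤ κ u' → κ v < κ v' := by
  classical
  obtain ⟨⟨hconn, -⟩, p, ⟨φ⟩⟩ := hG
  obtain ⟨v₀⟩ := hconn.nonempty
  by_cases hK : ∃ a b, G.Adj a b ∧ IsLeaf G a ∧ IsLeaf G b
  · -- a single edge
    obtain ⟨a, b, hab, ha, hb⟩ := hK
    have hall := eq_or_eq_of_adj_leaves hconn hab ha hb
    refine ⟨fun _ => 0, fun v => if v = a then 1 else s a b, fun v => ?_, fun u v huv => ?_, ?_⟩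
    · by_cases hv : v = a
      · simp [hv]
      · simpa [hv] using hs a b hab
    · rcases hall u with rfl | rfl <;> rcases hall v with rfl | rfl
      · exact absurd huv (G.loopless.irrefl _)
      · simp [hab.ne']
      · simp [hab.ne', hsymm]
      · exact absurd huv (G.loopless.irrefl _)
    · intro u v u' v' _ _ hsd hne
      exfalso
      rcases hall u with rfl | rfl <;> rcases hall u' with rfl | rfl
      · exact hne rfl
      · exact hside _ _ hab hsd
      · exact hside _ _ hab hsd.symm
      · exact hne rfl
  push Not at hK
  have hnbr : ∀ v, ∃ w, (IsLeaf G v → G.Adj v w) ∧ (¬ IsLeaf G v → w = v) := by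
    intro v
    by_cases hv : IsLeaf G v
    · obtain ⟨w, hw, -⟩ := id hv
      exact ⟨w, fun _ => hw, fun h => absurd hv h⟩
    · exact ⟨v, fun h => absurd h hv, fun _ => rfl⟩
  choose nbr hnbr1 hnbr2 using hnbr
  have hspine : ∀ v, ¬ IsLeaf G (nbr v) := by
    intro v
    by_cases hv : IsLeaf G v
    · exact hK v _ (hnbr1 v hv) hv
    · rwa [hnbr2 v hv]
  set κ : V → ℕ := fun v => (φ ⟨nbr v, hspine v⟩ : ℕ) with hκ
  set ψ : ℕ → V := fun l => if h : l < p then ((φ.symm ⟨l, h⟩ : _) : V) else v₀ with hψ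
  have hκS : ∀ v (hv : ¬ IsLeaf G v), κ v = φ ⟨v, hv⟩ := by
    intro v hv
    simp only [hκ, hnbr2 v hv]
  have hκlt : ∀ v, κ v < p := fun v => (φ ⟨nbr v, hspine v⟩).2
  have hψκ : ∀ v, ¬ IsLeaf G v → ψ (κ v) = v := by
    intro v hv
    simp only [hψ, hκlt v, dif_pos]
    have : (⟨κ v, hκlt v⟩ : Fin p) = φ ⟨v, hv⟩ := Fin.ext (hκS v hv)
    rw [this, φ.symm_apply_apply]
  have hinj : ∀ u v, ¬ IsLeaf G u → ¬ IsLeaf G v → u ≠ v → κ u ≠ κ v := by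
    intro u v hu hv hne h
    exact hne (by rw [← hψκ u hu, h, hψκ v hv])
  have hSS : ∀ u v, ¬ IsLeaf G u → ¬ IsLeaf G v → G.Adj u v → κ u + 1 = κ v ∨ κ v + 1 = κ u := by
    intro u v hu hv huv
    rw [hκS u hu, hκS v hv]
    exact SimpleGraph.pathGraph_adj.1 (φ.map_adj_iff.2 huv)
  have hLS : ∀ u v, IsLeaf G u → G.Adj u v → nbr u = v ∧ ¬ IsLeaf G v ∧ κ u = κ v := by
    intro u v hu huv
    have h1 : nbr u = v := hu.unique (hnbr1 u hu) huv
    have h2 : ¬ IsLeaf G v := h1 ▸ hspine u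
    refine ⟨h1, h2, ?_⟩
    rw [hκS v h2]
    simp only [hκ, h1]
  have hψadj : ∀ l, l + 1 < p → G.Adj (ψ l) (ψ (l + 1)) := by
    intro l hl
    simp only [hψ, hl, (show l < p by omega), dif_pos]
    have : (SimpleGraph.pathGraph p).Adj ⟨l, by omega⟩ ⟨l + 1, hl⟩ :=
      SimpleGraph.pathGraph_adj.2 (Or.inl rfl)
    exact φ.symm.map_adj_iff.2 this
  set E : ℕ → ℝ := fun i => ∏ l ∈ Finset.range i, s (ψ l) (ψ (l + 1)) with hE
  have hE1 : ∀ i < p, E i * E i = 1 := by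
    intro i hi
    rw [hE, ← Finset.prod_mul_distrib]
    exact Finset.prod_eq_one fun l hl => hs _ _ (hψadj l (by
      have := Finset.mem_range.1 hl
      omega))
  refine ⟨κ, fun v => if IsLeaf G v then E (κ v) * s v (nbr v) else E (κ v), ?_, ?_, ?_⟩
  · intro v
    by_cases hv : IsLeaf G v
    · simp only [hv, if_true]
      linear_combination s v (nbr v) * s v (nbr v) * hE1 _ (hκlt v) + hs _ _ (hnbr1 v hv)
    · simpa [hv] using hE1 _ (hκlt v)
  · intro u v huv
    by_cases hu : IsLeaf G u
    · obtain ⟨h1, h2, h3⟩ := hLS u v hu huv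
      simp only [hu, h2, if_true, if_false, h1, h3]
      linear_combination - s u v * hE1 _ (hκlt v)
    · by_cases hv : IsLeaf G v
      · obtain ⟨h1, h2, h3⟩ := hLS v u hv huv.symm
        simp only [hu, hv, if_true, if_false, h1, h3, hsymm u v]
        linear_combination - s v u * hE1 _ (hκlt u)
      · simp only [hu, hv, if_false]
        rcases hSS u v hu hv huv with h | h
        · have : E (κ v) = E (κ u) * s u v := by
            rw [← h]
            simp only [hE]
            rw [Finset.prod_range_succ, h, hψκ u hu, hψκ v hv]
          rw [this]
          linear_combination - s u v * hE1 _ (hκlt u)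
        · have : E (κ u) = E (κ v) * s u v := by
            rw [← h, hsymm u v]
            simp only [hE]
            rw [Finset.prod_range_succ, h, hψκ u hu, hψκ v hv]
          rw [this]
          linear_combination - s u v * hE1 _ (hκlt v)
  · intro u v u' v' h h' hsd hu hv hle
    have huv' : u ≠ v' := fun heq => hside _ _ h' (by rw [← hsd, heq])
    have hvu' : v ≠ u' := fun heq => hside _ _ h (by rw [hsd, heq])
    by_contra! hge
    by_cases lu : IsLeaf G u
    · obtain ⟨-, nv, h1⟩ := hLS u v lu h
      by_cases lu' : IsLeaf G u'
      · obtain ⟨-, nv', h2⟩ := hLS u' v' lu' h'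
        have := hinj v v' nv nv' hv
        omega
      · have h3 := hinj v u' nv lu' hvu'
        by_cases lv' : IsLeaf G v'
        · obtain ⟨-, -, h2⟩ := hLS v' u' lv' h'.symm
          omega
        · have h4 := hinj v v' nv lv' hv
          have h5 := hSS u' v' lu' lv' h'
          omega
    · by_cases lu' : IsLeaf G u'
      · obtain ⟨-, nv', h2⟩ := hLS u' v' lu' h'
        have h3 := hinj u v' lu nv' huv'
        by_cases lv : IsLeaf G v
        · obtain ⟨-, -, h1⟩ := hLS v u lv h.symm
          omega
        · have h4 := hinj v v' lv nv' hv
          have h5 := hSS u v lu lv h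
          omega
      · have h3 := hinj u u' lu lu' hu
        by_cases lv : IsLeaf G v
        · obtain ⟨-, -, h1⟩ := hLS v u lv h.symm
          by_cases lv' : IsLeaf G v'
          · obtain ⟨-, -, h2⟩ := hLS v' u' lv' h'.symm
            omega
          · have h4 := hinj u v' lu lv' huv'
            have h5 := hSS u' v' lu' lv' h'
            omega
        · have h6 := hinj v u' lv lu' hvu'
          have h5 := hSS u v lu lv h
          by_cases lv' : IsLeaf G v'
          · obtain ⟨-, -, h2⟩ := hLS v' u' lv' h'.symm
            omega
          · have h4 := hinj u v' lu lv' huv'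
            have h7 := hinj v v' lv lv' hv
            have h8 := hSS u' v' lu' lv' h'
            omega

/-- The layouts of the components of a caterpillar forest, placed side by side. -/
lemma IsCaterpillarForest.exists_layout {V : Type*} [Finite V] {G : SimpleGraph V}
    (hG : IsCaterpillarForest G)
    (side : V → Bool) (hside : ∀ u v, G.Adj u v → side u ≠ side v)
    (s : V → V → ℝ) (hsymm : ∀ u v, s u v = s v u) (hs : ∀ u v, G.Adj u v → s u v * s u v = 1) :
    ∃ (κ : V → ℕ) (ε : V → ℝ), (∀ v, ε v * ε v = 1) ∧ (∀ u v, G.Adj u v → s u v = ε u * ε v) ∧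
      ∀ u v u' v', G.Adj u v → G.Adj u' v' → side u = side u' → u ≠ u' → v ≠ v' →
        κ u ≤ κ u' → κ v < κ v' := by
  classical
  have hcomp : ∀ c : G.ConnectedComponent, _ := fun c =>
    (hG.2 c).exists_layout (fun v => side v) (fun u v h => hside u v h) (fun u v => s u v)
      (fun u v => hsymm u v) (fun u v h => hs u v h)
  choose κ ε hε hsign hnc using hcomp
  let mk : V → G.ConnectedComponent := G.connectedComponentMk
  let κ' : V → ℕ := fun v => κ (mk v) ⟨v, rfl⟩
  let ε' : V → ℝ := fun v => ε (mk v) ⟨v, rfl⟩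
  have hκ' : ∀ c v (h : v ∈ c), κ' v = κ c ⟨v, h⟩ := by
    rintro c v rfl
    rfl
  have hε' : ∀ c v (h : v ∈ c), ε' v = ε c ⟨v, h⟩ := by
    rintro c v rfl
    rfl
  have hadj : ∀ u v, G.Adj u v → v ∈ mk u := fun u v h =>
    SimpleGraph.ConnectedComponent.sound h.symm.reachable
  obtain ⟨idx, hidx⟩ := Countable.exists_injective_nat G.ConnectedComponent
  obtain ⟨K, hK⟩ : ∃ K, ∀ v, κ' v < K := by
    obtain ⟨B, hB⟩ := (Set.finite_range κ').bddAbove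
    exact ⟨B + 1, fun v => Nat.lt_succ_of_le (hB ⟨v, rfl⟩)⟩
  refine ⟨fun v => idx (mk v) * K + κ' v, ε', fun v => hε _ _, ?_, ?_⟩
  · intro u v h
    rw [hε' (mk u) u rfl, hε' (mk u) v (hadj u v h)]
    exact hsign (mk u) ⟨u, rfl⟩ ⟨v, hadj u v h⟩ h
  · intro u v u' v' h h' hsd hu hv hle
    have e1 : mk v = mk u := hadj u v h
    have e2 : mk v' = mk u' := hadj u' v' h'
    simp only [e1, e2]
    dsimp only at hle
    rcases lt_trichotomy (idx (mk u)) (idx (mk u')) with hlt | heq | hlt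
    · have := Nat.mul_le_mul_right K hlt
      have := hK v
      rw [Nat.succ_mul] at *
      omega
    · have hmk : mk u' = mk u := (hidx heq).symm
      simp only [hmk] at hle ⊢
      have hle' : κ' u ≤ κ' u' := by omega
      rw [hκ' (mk u) u rfl, hκ' (mk u) u' hmk] at hle'
      have := hnc (mk u) ⟨u, rfl⟩ ⟨v, e1⟩ ⟨u', hmk⟩ ⟨v', e2.trans hmk⟩ h h' hsd
        (fun h => hu (congrArg Subtype.val h)) (fun h => hv (congrArg Subtype.val h)) hle'
      rw [← hκ' (mk u) v e1, ← hκ' (mk u) v' (e2.trans hmk)] at this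
      omega
    · exfalso
      have := Nat.mul_le_mul_right K hlt
      have := hK u'
      rw [Nat.succ_mul] at *
      omega

/-- If `Γ_A` is a caterpillar forest, then after reordering the rows and columns, and changing the
signs of some of them, the matrix `A` is nonnegative and its nonzero entries do not cross. -/
lemma IsCaterpillarForest.exists_positions {n m : ℕ} {A : Matrix (Fin n) (Fin m) ℝ}
    (hA : IsCaterpillarForest (bipartiteGraph A)) :
    ∃ (e : Fin n → ℝ) (f : Fin m → ℝ) (ε : Fin n → ℝ) (δ : Fin m → ℝ),
      Function.Injective e ∧ Function.Injective f ∧ (∀ i, ε i * ε i = 1) ∧ (∀ j, δ j * δ j = 1) ∧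
      (∀ i j, 0 ≤ ε i * A i j * δ j) ∧
      ∀ i i' j j', A i j ≠ 0 → A i' j' ≠ 0 → i ≠ i' → j ≠ j' → (e i < e i' ↔ f j < f j') := by
  let s : Fin n ⊕ Fin m → Fin n ⊕ Fin m → ℝ := fun u v => match u, v with
    | Sum.inl i, Sum.inr j => (SignType.sign (A i j) : ℝ)
    | Sum.inr j, Sum.inl i => (SignType.sign (A i j) : ℝ)
    | _, _ => 0
  have hsq : ∀ a : ℝ, a ≠ 0 → ((SignType.sign a : ℝ)) * (SignType.sign a : ℝ) = 1 := by
    intro a ha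
    rcases lt_or_gt_of_ne ha with h | h <;> simp [h]
  obtain ⟨κ, ε, hε, hsign, hnc⟩ := hA.exists_layout Sum.isLeft
    (by rintro (i | j) (i' | j') h <;> simp_all [bipartiteGraph]) s
    (by rintro (i | j) (i' | j') <;> rfl)
    (by
      rintro (i | j) (i' | j') h
      · exact h.elim
      · exact hsq _ h
      · exact hsq _ h
      · exact h.elim)
  have hinj : ∀ (N : ℕ) (g : Fin N → ℕ),
      Function.Injective fun i : Fin N => ((g i * N + i : ℕ) : ℝ) := by
    intro N g a b hab
    have h1 : g a * N + a = g b * N + b := Nat.cast_injective hab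
    have h2 := congrArg (· % N) h1
    simp only [Nat.mul_add_mod', Nat.mod_eq_of_lt a.2, Nat.mod_eq_of_lt b.2] at h2
    exact Fin.ext h2
  have hlt : ∀ (N : ℕ) (g : Fin N → ℕ) (a b : Fin N),
      ((g a * N + a : ℕ) : ℝ) < ((g b * N + b : ℕ) : ℝ) → g a ≤ g b := by
    intro N g a b hab
    have h1 : g a * N + a < g b * N + b := by exact_mod_cast hab
    by_contra! h
    have := Nat.mul_le_mul_right N h
    rw [Nat.succ_mul] at this
    have := b.2
    omega
  have hgt : ∀ (N : ℕ) (g : Fin N → ℕ) (a b : Fin N), g a < g b →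
      ((g a * N + a : ℕ) : ℝ) < ((g b * N + b : ℕ) : ℝ) := by
    intro N g a b hab
    have := Nat.mul_le_mul_right N hab
    rw [Nat.succ_mul] at this
    have := a.2
    exact_mod_cast (by omega : g a * N + a < g b * N + b)
  have hfwd : ∀ i i' j j', A i j ≠ 0 → A i' j' ≠ 0 → i ≠ i' → j ≠ j' →
      κ (Sum.inl i) ≤ κ (Sum.inl i') → κ (Sum.inr j) < κ (Sum.inr j') :=
    fun i i' j j' h h' hi hj => hnc (Sum.inl i) (Sum.inr j) (Sum.inl i') (Sum.inr j') h h' rfl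
      (by simpa using hi) (by simpa using hj)
  have hbwd : ∀ i i' j j', A i j ≠ 0 → A i' j' ≠ 0 → i ≠ i' → j ≠ j' →
      κ (Sum.inr j) ≤ κ (Sum.inr j') → κ (Sum.inl i) < κ (Sum.inl i') :=
    fun i i' j j' h h' hi hj => hnc (Sum.inr j) (Sum.inl i) (Sum.inr j') (Sum.inl i') h h' rfl
      (by simpa using hj) (by simpa using hi)
  refine ⟨fun i => ((κ (Sum.inl i) * n + i : ℕ) : ℝ), fun j => ((κ (Sum.inr j) * m + j : ℕ) : ℝ),
    fun i => ε (Sum.inl i), fun j => ε (Sum.inr j), hinj n _, hinj m _, fun i => hε _,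
    fun j => hε _, fun i j => ?_, fun i i' j j' h h' hi hj => ⟨fun hl => ?_, fun hl => ?_⟩⟩
  · by_cases h : A i j = 0
    · simp [h]
    · have h1 : (SignType.sign (A i j) : ℝ) = ε (Sum.inl i) * ε (Sum.inr j) :=
        hsign (Sum.inl i) (Sum.inr j) h
      have h2 : ε (Sum.inl i) * A i j * ε (Sum.inr j) = |A i j| := by
        rw [← sign_mul_self (A i j), h1]
        ring
      rw [h2]
      exact abs_nonneg _
  · exact hgt m (fun j => κ (Sum.inr j)) j j'
      (hfwd i i' j j' h h' hi hj (hlt n (fun i => κ (Sum.inl i)) i i' hl))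
  · exact hgt n (fun i => κ (Sum.inl i)) i i'
      (hbwd i i' j j' h h' hi hj (hlt m (fun j => κ (Sum.inr j)) j j' hl))

/-! ### Products for caterpillar forests -/

lemma map_ofReal_mul {α β γ : Type*} [Fintype β] (S : Matrix α β ℝ) (T : Matrix β γ ℝ) :
    (S * T).map (fun x : ℝ => (x : ℂ)) =
      S.map (fun x : ℝ => (x : ℂ)) * T.map (fun x : ℝ => (x : ℂ)) :=
  Matrix.map_mul (f := Complex.ofRealHom)

/-- If `P` has a left inverse and intertwines `N` with `M`, then every eigenvalue of `N` is one
of `M`. -/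
lemma complexSpectrum_subset_of_intertwining {ι κ : Type*} [Fintype ι] [DecidableEq ι] [Fintype κ]
    [DecidableEq κ] {M : Matrix ι ι ℝ} {N : Matrix κ κ ℝ} {P : Matrix ι κ ℝ} {Q : Matrix κ ι ℝ}
    (hQP : Q * P = 1) (h : M * P = P * N) : complexSpectrum N ⊆ complexSpectrum M := by
  intro z hz
  obtain ⟨v, hv0, hv⟩ := mem_complexSpectrum_iff_exists.1 hz
  refine mem_complexSpectrum_iff_exists.2 ⟨P.map (fun x : ℝ => (x : ℂ)) *ᵥ v, fun h0 => hv0 ?_, ?_⟩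
  · have h1 := congrArg (Q.map (fun x : ℝ => (x : ℂ)) *ᵥ ·) h0
    simp only [Matrix.mulVec_mulVec, Matrix.mulVec_zero] at h1
    rw [← map_ofReal_mul, hQP, Matrix.map_one _ Complex.ofReal_zero Complex.ofReal_one,
      Matrix.one_mulVec] at h1
    exact h1
  · rw [Matrix.mulVec_mulVec, ← map_ofReal_mul, h, map_ofReal_mul, ← Matrix.mulVec_mulVec, hv, Matrix.mulVec_smul]

lemma sign_eq_of_mem_qualClass {n m : ℕ} {A B : Matrix (Fin n) (Fin m) ℝ} (hB : B ∈ qualClass A)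
    (i : Fin n) (j : Fin m) : SignType.sign (B i j) = SignType.sign (A i j) :=
  congrFun (congrFun hB i) j

/-- For a caterpillar forest, all products in `𝒬²ᵏ(A)` become variation diminishing after the
same signature similarity. -/
lemma IsCaterpillarForest.exists_variationDiminishing {n m : ℕ} {A : Matrix (Fin n) (Fin m) ℝ}
    (hA : IsCaterpillarForest (bipartiteGraph A)) :
    ∃ (e ε : Fin n → ℝ), Function.Injective e ∧ (∀ i, ε i * ε i = 1) ∧
      ∀ k, ∀ M ∈ evenQualProducts A k,
        VariationDiminishing e e (diagonal ε * M * diagonal ε) := by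
  obtain ⟨e, f, ε, δ, he, hf, hε, hδ, hnonneg, hnc⟩ := hA.exists_positions
  refine ⟨e, ε, he, hε, ?_⟩
  have hε1 : diagonal ε * diagonal ε = (1 : Matrix (Fin n) (Fin n) ℝ) := by
    rw [diagonal_mul_diagonal, ← diagonal_one]
    exact congrArg _ (funext hε)
  have hδ1 : diagonal δ * diagonal δ = (1 : Matrix (Fin m) (Fin m) ℝ) := by
    rw [diagonal_mul_diagonal, ← diagonal_one]
    exact congrArg _ (funext hδ)
  have happly : ∀ (B : Matrix (Fin n) (Fin m) ℝ) i j,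
      (diagonal ε * B * diagonal δ) i j = ε i * B i j * δ j := by
    intro B i j
    rw [Matrix.mul_diagonal, Matrix.diagonal_mul]
  have hpos : ∀ B ∈ qualClass A, ∀ i j, 0 ≤ (diagonal ε * B * diagonal δ) i j := by
    intro B hB i j
    have h1 := sign_eq_of_mem_qualClass hB i j
    have h2 := hnonneg i j
    rw [happly]
    rw [← sign_nonneg_iff] at h2 ⊢
    simpa only [sign_mul, h1] using h2
  have hne : ∀ B ∈ qualClass A, ∀ i j, (diagonal ε * B * diagonal δ) i j ≠ 0 → A i j ≠ 0 := by
    intro B hB i j h hA0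
    have h1 := sign_eq_of_mem_qualClass hB i j
    rw [hA0, sign_zero, sign_eq_zero_iff] at h1
    rw [happly, h1] at h
    simp at h
  have hB : ∀ B ∈ qualClass A, VariationDiminishing f e (diagonal ε * B * diagonal δ) := by
    intro B hB
    refine VariationDiminishing.of_noncrossing (hpos B hB) fun i i' j j' h h' hj hlt => ?_
    exact (hnc i i' j j' (hne B hB _ _ h) (hne B hB _ _ h') (fun h => hlt.ne (congrArg e h)) hj).1
      hlt
  have hC : ∀ B ∈ qualClass A, VariationDiminishing e f (diagonal ε * B * diagonal δ)ᵀ := by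
    intro B hB
    refine VariationDiminishing.of_noncrossing (fun i j => hpos B hB j i)
      fun j j' i i' h h' hi hlt => ?_
    exact (hnc i i' j j' (hne B hB _ _ h) (hne B hB _ _ h') hi (fun h => hlt.ne (congrArg f h))).2
      hlt
  rintro k M ⟨B, C, hBA, hCA, rfl⟩
  have hconj : ∀ L : List (Matrix (Fin n) (Fin n) ℝ), diagonal ε * L.prod * diagonal ε =
      (L.map fun N => diagonal ε * N * diagonal ε).prod := by
    intro L
    induction L with
    | nil => simpa using hε1
    | cons N L ih =>
      rw [List.prod_cons, List.map_cons, List.prod_cons, ← ih]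
      calc diagonal ε * (N * L.prod) * diagonal ε
          = diagonal ε * N * 1 * L.prod * diagonal ε := by simp only [Matrix.mul_assoc, one_mul]
        _ = _ := by rw [← hε1]; simp only [Matrix.mul_assoc]
  rw [hconj]
  refine VariationDiminishing.listProd fun N hN => ?_
  obtain ⟨_, hN', rfl⟩ := List.mem_map.1 hN
  obtain ⟨i, rfl⟩ := (List.mem_ofFn' _ _).1 hN'
  have : diagonal ε * (B i * (C i)ᵀ) * diagonal ε =
      (diagonal ε * B i * diagonal δ) * (diagonal ε * C i * diagonal δ)ᵀ := by
    calc diagonal ε * (B i * (C i)ᵀ) * diagonal ε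
        = diagonal ε * B i * (1 : Matrix (Fin m) (Fin m) ℝ) * (C i)ᵀ * diagonal ε := by
          simp only [Matrix.mul_assoc, Matrix.one_mul]
      _ = _ := by
        rw [← hδ1]
        simp only [Matrix.transpose_mul, Matrix.diagonal_transpose, Matrix.mul_assoc]
  rw [this]
  exact (hB _ (hBA i)).mul (hC _ (hCA i))

theorem IsCaterpillarForest.evenQualProducts_subset_PSMatrices {n m : ℕ}
    {A : Matrix (Fin n) (Fin m) ℝ} (hA : IsCaterpillarForest (bipartiteGraph A)) (k : ℕ) :
    evenQualProducts A k ⊆ PSMatrices n := by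
  intro M hM
  obtain ⟨e, ε, he, hε, h⟩ := hA.exists_variationDiminishing
  have hε1 : diagonal ε * diagonal ε = (1 : Matrix (Fin n) (Fin n) ℝ) := by
    rw [diagonal_mul_diagonal, ← diagonal_one]
    exact congrArg _ (funext hε)
  refine (complexSpectrum_subset_of_intertwining (N := M) hε1 ?_).trans
    ((h k M hM).complexSpectrum_subset he)
  rw [Matrix.mul_assoc, hε1, Matrix.mul_one]

theorem IsCaterpillarForest.evenQualProducts_subset_P0Matrices {n m : ℕ}
    {A : Matrix (Fin n) (Fin m) ℝ} (hA : IsCaterpillarForest (bipartiteGraph A)) (k : ℕ) :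
    evenQualProducts A k ⊆ P0Matrices n := by
  intro M hM s
  obtain ⟨e, ε, he, hε, h⟩ := hA.exists_variationDiminishing
  have h1 := (h k M hM).principalMinor_nonneg he s
  have h2 : (diagonal ε * M * diagonal ε).submatrix (fun i : s => (i : Fin n))
      (fun i : s => (i : Fin n)) = diagonal (fun i : s => ε i) *
        M.submatrix (fun i : s => (i : Fin n)) (fun i : s => (i : Fin n)) *
          diagonal (fun i : s => ε i) := by
    ext i j
    simp only [Matrix.submatrix_apply, Matrix.mul_diagonal, Matrix.diagonal_mul]
  have h3 : ∏ i : s, ε i * ε i = 1 := Finset.prod_eq_one fun i _ => hε i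
  rwa [h2, det_mul, det_mul, mul_right_comm, ← det_mul, diagonal_mul_diagonal, det_diagonal,
    h3, one_mul] at h1

/-! ### Degenerate sign patterns and placements of submatrices -/

/-- `B` arises from a matrix in `𝒬(A)` by replacing some entries by zero, that is, `B` lies in the
closure of `𝒬(A)`. -/
def IsSubpattern {n m : Type*} (A B : Matrix n m ℝ) : Prop :=
  ∀ i j, B i j = 0 ∨ SignType.sign (B i j) = SignType.sign (A i j)

lemma IsSubpattern.add_smul_mem_qualClass {n m : ℕ} {A B : Matrix (Fin n) (Fin m) ℝ}
    (h : IsSubpattern A B) {t : ℝ} (ht : 0 < t) : B + t • A ∈ qualClass A := by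
  ext i j
  simp only [signPattern, Matrix.map_apply, Matrix.add_apply, Matrix.smul_apply, smul_eq_mul]
  rcases h i j with h0 | h1
  · rw [h0, zero_add, sign_mul, sign_pos ht, one_mul]
  · rcases lt_trichotomy (A i j) 0 with hA | hA | hA
    · rw [sign_neg hA, sign_eq_neg_one_iff] at h1
      rw [sign_neg hA, sign_neg]
      nlinarith
    · rw [hA, sign_zero, sign_eq_zero_iff] at h1
      rw [hA, h1, mul_zero, add_zero]
    · rw [sign_pos hA, sign_eq_one_iff] at h1
      rw [sign_pos hA, sign_pos]
      positivity

/-- A closed set containing `𝒬²ᵏ(A)` also contains the products of degenerate factors. -/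
lemma listProd_mem_of_isSubpattern {n m k : ℕ} {A : Matrix (Fin n) (Fin m) ℝ}
    {S : Set (Matrix (Fin n) (Fin n) ℝ)} (hS : IsClosed S) (h : evenQualProducts A k ⊆ S)
    {B C : Fin k → Matrix (Fin n) (Fin m) ℝ} (hB : ∀ i, IsSubpattern A (B i))
    (hC : ∀ i, IsSubpattern A (C i)) : (List.ofFn fun i => B i * (C i)ᵀ).prod ∈ S := by
  let F : ℝ → Matrix (Fin n) (Fin n) ℝ := fun t =>
    (List.ofFn fun i => (B i + t • A) * (C i + t • A)ᵀ).prod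
  have hcont : Continuous F := by
    simp only [F, List.ofFn_eq_map]
    refine continuous_list_prod _ fun i _ => ?_
    exact (continuous_const.add (continuous_id.smul continuous_const)).matrix_mul
      (continuous_const.add (continuous_id.smul continuous_const)).matrix_transpose
  have h0 : F 0 = (List.ofFn fun i => B i * (C i)ᵀ).prod := by simp [F]
  have hlim : Filter.Tendsto F (nhdsWithin 0 (Set.Ioi 0)) (nhds (F 0)) :=
    hcont.continuousAt.tendsto.mono_left nhdsWithin_le_nhds
  rw [← h0]
  refine hS.mem_of_tendsto hlim ?_
  filter_upwards [self_mem_nhdsWithin] with t ht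
  exact h ⟨fun i => B i + t • A, fun i => C i + t • A,
    fun i => (hB i).add_smul_mem_qualClass ht, fun i => (hC i).add_smul_mem_qualClass ht, rfl⟩

/-- The matrix whose column `a` is the unit vector at `f a`. For injective `f`,
`placement f * N * (placement g)ᵀ` is the matrix with block `N` in the rows `f` and columns `g` and
with zeros elsewhere. -/
def placement {α β : Type*} [DecidableEq α] (f : β → α) : Matrix α β ℝ :=
  Matrix.of fun i a => if i = f a then 1 else 0

section Placement

variable {α α' β β' γ : Type*} [DecidableEq α] [DecidableEq α'] [Fintype β] [Fintype β']

lemma placement_mul_mul_transpose_apply (f : β → α) (g : β' → α') (N : Matrix β β' ℝ) (i : α)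
    (j : α') : (placement f * N * (placement g)ᵀ) i j =
      ∑ b, ∑ a, (if i = f a then N a b else 0) * if j = g b then 1 else 0 := by
  simp only [placement, Matrix.mul_apply, Matrix.transpose_apply, Matrix.of_apply, ite_mul,
    one_mul, zero_mul, Finset.sum_mul]

variable [DecidableEq β] [DecidableEq β']

omit [Fintype β] in
lemma placement_transpose_mul_self [Fintype α] {f : β → α} (hf : Function.Injective f) :
    (placement f)ᵀ * placement f = 1 := by
  ext a b
  simp only [placement, Matrix.mul_apply, Matrix.transpose_apply, Matrix.of_apply]
  rw [Finset.sum_eq_single (f a)]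
  · simp [Matrix.one_apply, hf.eq_iff]
  · intro i _ hi
    simp [hi]
  · simp

lemma isSubpattern_placement {f : β → α} {g : β' → α'} (hf : Function.Injective f)
    (hg : Function.Injective g) {A : Matrix α α' ℝ} {N : Matrix β β' ℝ}
    (h : IsSubpattern (A.submatrix f g) N) :
    IsSubpattern A (placement f * N * (placement g)ᵀ) := by
  intro i j
  rw [placement_mul_mul_transpose_apply]
  by_cases hi : ∃ a, i = f a
  · by_cases hj : ∃ b, j = g b
    · obtain ⟨a, rfl⟩ := hi
      obtain ⟨b, rfl⟩ := hj
      simpa [hf.eq_iff, hg.eq_iff] using h a b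
    · push Not at hj
      simp [hj]
  · push Not at hi
    simp [hi]

omit [DecidableEq β] in
lemma placement_block_mul [Fintype α'] {δ : Type*} [Fintype δ] [DecidableEq γ] {f : β → α}
    {g : β' → α'} (hg : Function.Injective g) {f' : δ → γ} (N : Matrix β β' ℝ)
    (N' : Matrix β' δ ℝ) :
    placement f * N * (placement g)ᵀ * (placement g * N' * (placement f')ᵀ) =
      placement f * (N * N') * (placement f')ᵀ := by
  calc placement f * N * (placement g)ᵀ * (placement g * N' * (placement f')ᵀ)
      = placement f * N * ((placement g)ᵀ * placement g) * N' * (placement f')ᵀ := by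
        simp only [Matrix.mul_assoc]
    _ = _ := by
        rw [placement_transpose_mul_self hg, Matrix.mul_one]
        simp only [Matrix.mul_assoc]

end Placement

lemma complexSpectrum_subset_placement {α β : Type*} [Fintype α] [DecidableEq α] [Fintype β]
    [DecidableEq β] {f : β → α} (hf : Function.Injective f) (N : Matrix β β ℝ) :
    complexSpectrum N ⊆ complexSpectrum (placement f * N * (placement f)ᵀ) :=
  complexSpectrum_subset_of_intertwining (placement_transpose_mul_self hf) (by
    rw [Matrix.mul_assoc _ (placement f)ᵀ, placement_transpose_mul_self hf, Matrix.mul_one])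

lemma det_nonneg_of_placement_mem_P0Matrices {n t : ℕ} {f : Fin t → Fin n}
    (hf : Function.Injective f) {N : Matrix (Fin t) (Fin t) ℝ}
    (h : placement f * N * (placement f)ᵀ ∈ P0Matrices n) : 0 ≤ N.det := by
  have h1 := h (Finset.univ.image f)
  let φ : Fin t ≃ (Finset.univ.image f : Finset (Fin n)) :=
    Equiv.ofBijective (fun a => ⟨f a, Finset.mem_image_of_mem f (Finset.mem_univ a)⟩)
      ⟨fun a b hab => hf (congrArg Subtype.val hab), by
        rintro ⟨i, hi⟩
        obtain ⟨a, -, rfl⟩ := Finset.mem_image.1 hi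
        exact ⟨a, rfl⟩⟩
  rw [← det_submatrix_equiv_self φ, Matrix.submatrix_submatrix] at h1
  convert h1 using 2
  ext a b
  rw [Matrix.submatrix_apply, placement_mul_mul_transpose_apply]
  have hφ : ∀ a, ((φ a : (Finset.univ.image f : Finset (Fin n))) : Fin n) = f a := fun _ => rfl
  simp [hφ, hf.eq_iff]

/-! ### Moving tokens along edges -/

section Tokens

variable {n m t k : ℕ} {A : Matrix (Fin n) (Fin m) ℝ}

/-- Let `t` tokens move from distinct rows `f 0` through distinct columns `g 0` to distinct
rows `f 1`, and so on, up to the rows `f (k + 1)`. Then every closed set containing `𝒬²⁽ᵏ⁺¹⁾(A)` has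
as an element the matrix with one entry for each token, in the row where it starts and the column
with the index of the row where it ends: the product of the entries of `A` on its way. Each factor
of the product keeps only the entries of `A` that the tokens use at that moment. -/
lemma tokenMatrix_mem {S : Set (Matrix (Fin n) (Fin n) ℝ)} (hS : IsClosed S)
    (h : evenQualProducts A (k + 1) ⊆ S) {f : ℕ → Fin t → Fin n} {g : ℕ → Fin t → Fin m}
    (hf : ∀ s, Function.Injective (f s)) (hg : ∀ s, Function.Injective (g s)) :
    placement (f 0) * diagonal (fun a => ∏ s ∈ Finset.range (k + 1),
      (A (f s a) (g s a) * A (f (s + 1) a) (g s a))) * (placement (f (k + 1)))ᵀ ∈ S := by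
  have hstep : ∀ s, placement (f s) * diagonal (fun a => A (f s a) (g s a)) * (placement (g s))ᵀ *
      (placement (f (s + 1)) * diagonal (fun a => A (f (s + 1) a) (g s a)) * (placement (g s))ᵀ)ᵀ =
      placement (f s) * diagonal (fun a => A (f s a) (g s a) * A (f (s + 1) a) (g s a)) *
        (placement (f (s + 1)))ᵀ := by
    intro s
    rw [Matrix.transpose_mul, Matrix.transpose_mul, Matrix.transpose_transpose,
      Matrix.diagonal_transpose, ← Matrix.mul_assoc (placement (g s)),
      placement_block_mul (hg s), diagonal_mul_diagonal]
  have hprod : ∀ r : ℕ, (List.ofFn fun s : Fin (r + 1) =>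
      placement (f s) * diagonal (fun a => A (f s a) (g s a)) * (placement (g s))ᵀ *
      (placement (f (s + 1)) * diagonal (fun a => A (f (s + 1) a) (g s a)) *
        (placement (g s))ᵀ)ᵀ).prod =
      placement (f 0) * diagonal (fun a => ∏ s ∈ Finset.range (r + 1),
        (A (f s a) (g s a) * A (f (s + 1) a) (g s a))) * (placement (f (r + 1)))ᵀ := by
    intro r
    induction r with
    | zero => simpa using hstep 0
    | succ r ih =>
      rw [List.ofFn_succ', List.concat_eq_append, List.prod_append, List.prod_singleton]
      simp only [Fin.val_castSucc, Fin.val_last]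
      rw [ih, hstep, placement_block_mul (hf _), diagonal_mul_diagonal]
      simp only [Finset.prod_range_succ _ (r + 1)]
  rw [← hprod k]
  have hdiag : ∀ (p : Fin t → Fin n) (q : Fin t → Fin m),
      IsSubpattern (A.submatrix p q) (diagonal fun a => A (p a) (q a)) := by
    intro p q a b
    by_cases hab : a = b
    · subst hab
      simp
    · simp [hab]
  exact listProd_mem_of_isSubpattern hS h (fun s => isSubpattern_placement (hf _) (hg _) (hdiag _ _))
    fun s => isSubpattern_placement (hf _) (hg _) (hdiag _ _)

lemma placement_comp_perm (f : Fin t → Fin n) (π : Equiv.Perm (Fin t)) :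
    (placement (f ∘ π))ᵀ = π.permMatrix ℝ * (placement f)ᵀ := by
  ext a i
  simp only [placement, Matrix.mul_apply, Equiv.Perm.permMatrix, PEquiv.toMatrix_apply,
    Matrix.transpose_apply, Matrix.of_apply, Function.comp, Equiv.toPEquiv_apply, Option.mem_some_iff]
  rw [Finset.sum_eq_single (π a)]
  · simp
  · intro b _ hb
    simp [hb.symm]
  · simp

/-- If the tokens end on their starting rows, permuted by `π`, then the principal minor on
these rows is the sign of `π` times the product of the weights. -/
lemma sign_mul_prod_nonneg (h : evenQualProducts A (k + 1) ⊆ P0Matrices n)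
    {f : ℕ → Fin t → Fin n} {g : ℕ → Fin t → Fin m}
    (hf : ∀ s, Function.Injective (f s)) (hg : ∀ s, Function.Injective (g s))
    {π : Equiv.Perm (Fin t)} (hπ : f (k + 1) = f 0 ∘ π) :
    0 ≤ ((Equiv.Perm.sign π : ℤ) : ℝ) * ∏ a, ∏ s ∈ Finset.range (k + 1),
      (A (f s a) (g s a) * A (f (s + 1) a) (g s a)) := by
  have h1 := tokenMatrix_mem (isClosed_P0Matrices n) h hf hg
  rw [hπ, placement_comp_perm, ← Matrix.mul_assoc, Matrix.mul_assoc (placement (f 0))] at h1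
  have h2 := det_nonneg_of_placement_mem_P0Matrices (hf 0) h1
  rwa [det_mul, det_diagonal, Matrix.det_permutation, mul_comm] at h2

/-- If the tokens end on their starting rows, and none on its own one, then the matrix of the tokens
has trace zero; it is singular if its eigenvalues are nonnegative. -/
lemma prod_eq_zero_of_subset_PSMatrices [NeZero t] (h : evenQualProducts A (k + 1) ⊆ PSMatrices n)
    {f : ℕ → Fin t → Fin n} {g : ℕ → Fin t → Fin m}
    (hf : ∀ s, Function.Injective (f s)) (hg : ∀ s, Function.Injective (g s))
    {π : Equiv.Perm (Fin t)} (hfix : ∀ a, π a ≠ a) (hπ : f (k + 1) = f 0 ∘ π) :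
    ∏ a, ∏ s ∈ Finset.range (k + 1), (A (f s a) (g s a) * A (f (s + 1) a) (g s a)) = 0 := by
  have h1 := tokenMatrix_mem (isClosed_PSMatrices n) h hf hg
  rw [hπ, placement_comp_perm, ← Matrix.mul_assoc, Matrix.mul_assoc (placement (f 0))] at h1
  have h2 := det_eq_zero_of_trace_eq_zero ((complexSpectrum_subset_placement (hf 0) _).trans h1) (by
    simp [Matrix.trace, Matrix.diagonal_mul, Equiv.Perm.permMatrix, PEquiv.toMatrix_apply, hfix])
  rw [det_mul, det_diagonal, Matrix.det_permutation] at h2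
  refine (mul_eq_zero.1 h2).resolve_right ?_
  simp

end Tokens

/-! ### Cycles -/

section Cycle

variable {n m l : ℕ} {A : Matrix (Fin n) (Fin m) ℝ}

/-- The rows `x` and columns `y` form a cycle of `Γ_A` of length `2 l`: `y a` is adjacent to `x a`
and to the cyclically next row. -/
structure IsRowColumnCycle (A : Matrix (Fin n) (Fin m) ℝ) (x : Fin l → Fin n) (y : Fin l → Fin m) :
    Prop where
  injective_row : Function.Injective x
  injective_col : Function.Injective y
  ne_zero : ∀ a, A (x a) (y a) ≠ 0
  rotate_ne_zero : ∀ a, A (x (finRotate l a)) (y a) ≠ 0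

/-- On a cycle, let all `l + 2` tokens rotate by one step. -/
lemma IsRowColumnCycle.not_subset_PSMatrices {x : Fin (l + 2) → Fin n} {y : Fin (l + 2) → Fin m}
    (hc : IsRowColumnCycle A x y) : ¬ evenQualProducts A 2 ⊆ PSMatrices n := by
  intro h
  have hrot := (finRotate (l + 2)).injective
  let f : ℕ → Fin (l + 2) → Fin n := fun s => match s with
    | 0 => x
    | _ => x ∘ finRotate (l + 2)
  let g : ℕ → Fin (l + 2) → Fin m := fun s => match s with
    | 0 => y
    | _ => y ∘ finRotate (l + 2)
  have h1 := prod_eq_zero_of_subset_PSMatrices (π := finRotate (l + 2)) h (f := f) (g := g)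
    (by rintro (_ | s); exacts [hc.injective_row, hc.injective_row.comp hrot])
    (by rintro (_ | s); exacts [hc.injective_col, hc.injective_col.comp hrot])
    (fun a => by simp) rfl
  obtain ⟨a, -, ha⟩ := Finset.prod_eq_zero_iff.1 h1
  simp only [Finset.prod_range_succ, Finset.prod_range_zero, one_mul, f, g, Function.comp,
    mul_eq_zero, hc.ne_zero, hc.rotate_ne_zero, or_self] at ha

/-- On a cycle of length `2 (l + 2)`, both the rotation of `l + 2` tokens by one step and
the rotation of `l + 1` tokens, each to the place of the next one, carry the product of all entries
on the cycle as a weight, up to squares. The signs of these cyclic permutations are opposite. -/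
lemma IsRowColumnCycle.not_subset_P0Matrices {x : Fin (l + 2) → Fin n} {y : Fin (l + 2) → Fin m}
    (hc : IsRowColumnCycle A x y) : ¬ evenQualProducts A 3 ⊆ P0Matrices n := by
  intro h
  have hrot := (finRotate (l + 2)).injective
  have hrot' := (finRotate (l + 1)).injective
  set p : Fin (l + 2) → ℝ := fun a => A (x a) (y a) with hp
  set q : Fin (l + 2) → ℝ := fun a => A (x (finRotate (l + 2) a)) (y a) with hq
  have hp0 : ∀ a, p a ≠ 0 := hc.ne_zero
  have hq0 : ∀ a, q a ≠ 0 := hc.rotate_ne_zero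
  have hsq : ∀ {N : ℕ} (r : Fin N → ℝ), (∀ a, r a ≠ 0) → 0 < ∏ a, (r a * r a) := fun r hr =>
    Finset.prod_pos fun a _ => mul_self_pos.2 (hr a)
  let f₀ : ℕ → Fin (l + 2) → Fin n := fun s => match s with
    | 0 => x
    | _ => x ∘ finRotate (l + 2)
  let g₀ : ℕ → Fin (l + 2) → Fin m := fun s => match s with
    | 0 => y
    | _ => y ∘ finRotate (l + 2)
  have h1 := sign_mul_prod_nonneg (π := finRotate (l + 2)) h (f := f₀) (g := g₀)
    (by rintro (_ | s); exacts [hc.injective_row, hc.injective_row.comp hrot])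
    (by rintro (_ | s); exacts [hc.injective_col, hc.injective_col.comp hrot]) rfl
  have e1 : ∀ a, ∏ s ∈ Finset.range (2 + 1), (A (f₀ s a) (g₀ s a) * A (f₀ (s + 1) a) (g₀ s a))
      = p a * q a * (p (finRotate (l + 2) a) * p (finRotate (l + 2) a)) *
        (p (finRotate (l + 2) a) * p (finRotate (l + 2) a)) := by
    intro a
    simp only [Finset.prod_range_succ, Finset.prod_range_zero, one_mul, hp, hq, f₀, g₀, Function.comp]
  rw [Finset.prod_congr rfl fun a _ => e1 a, Finset.prod_mul_distrib, Finset.prod_mul_distrib,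
    ← mul_assoc, ← mul_assoc] at h1
  have h1' := nonneg_of_mul_nonneg_left (nonneg_of_mul_nonneg_left h1
    (hsq _ fun a => hp0 (finRotate (l + 2) a))) (hsq _ fun a => hp0 (finRotate (l + 2) a))
  let c : Fin (l + 1) → Fin (l + 2) := Fin.castSucc
  let d : Fin (l + 1) → Fin (l + 2) := Fin.succ
  have hci : Function.Injective c := Fin.castSucc_injective _
  have hdi : Function.Injective d := Fin.succ_injective _
  have hcd : ∀ a, finRotate (l + 2) (c a) = d a := fun a => by
    rw [finRotate_apply]
    exact Fin.coeSucc_eq_succ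
  let f : ℕ → Fin (l + 1) → Fin n := fun s => match s with
    | 0 => x ∘ c
    | 1 => x ∘ d
    | _ => x ∘ c ∘ finRotate (l + 1)
  let g : ℕ → Fin (l + 1) → Fin m := fun s => match s with
    | 0 => y ∘ c
    | 1 => y ∘ d
    | _ => y ∘ c ∘ finRotate (l + 1)
  have h2 := sign_mul_prod_nonneg (π := finRotate (l + 1)) h (f := f) (g := g)
    (by
      rintro (_ | _ | s)
      exacts [hc.injective_row.comp hci, hc.injective_row.comp hdi,
        hc.injective_row.comp (hci.comp hrot')])
    (by
      rintro (_ | _ | s)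
      exacts [hc.injective_col.comp hci, hc.injective_col.comp hdi,
        hc.injective_col.comp (hci.comp hrot')]) rfl
  have e2 : ∀ a, ∏ s ∈ Finset.range (2 + 1), (A (f s a) (g s a) * A (f (s + 1) a) (g s a)) =
      p (c a) * q (c a) * (p (d a) * A (x (c (finRotate (l + 1) a))) (y (d a))) *
        (p (c (finRotate (l + 1) a)) * p (c (finRotate (l + 1) a))) := by
    intro a
    simp only [Finset.prod_range_succ, Finset.prod_range_zero, one_mul, hp, hq, hcd, f, g,
      Function.comp]
  have e3 : ∏ a, (p (d a) * A (x (c (finRotate (l + 1) a))) (y (d a))) =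
      (∏ b : Fin l, (p (d b.castSucc) * p (d b.castSucc))) *
        (p (Fin.last (l + 1)) * q (Fin.last (l + 1))) := by
    rw [Fin.prod_univ_castSucc]
    congr 1
    · refine Finset.prod_congr rfl fun b _ => ?_
      have : c (finRotate (l + 1) b.castSucc) = d b.castSucc := by
        rw [finRotate_apply, Fin.coeSucc_eq_succ]
        rfl
      rw [this]
    · have h3 : c (finRotate (l + 1) (Fin.last l)) = finRotate (l + 2) (Fin.last (l + 1)) := by
        rw [finRotate_last, finRotate_last]
        rfl
      have h4 : d (Fin.last l) = Fin.last (l + 1) := rfl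
      rw [h3, h4]
  rw [Finset.prod_congr rfl fun a _ => e2 a, Finset.prod_mul_distrib, Finset.prod_mul_distrib, e3,
    ← mul_assoc] at h2
  have h2' := nonneg_of_mul_nonneg_left h2 (hsq _ fun a => hp0 (c (finRotate (l + 1) a)))
  have e4 : ∏ a, p a * q a = (∏ a, (p (c a) * q (c a))) *
      (p (Fin.last (l + 1)) * q (Fin.last (l + 1))) := Fin.prod_univ_castSucc _
  have h2'' : 0 ≤ ((Equiv.Perm.sign (finRotate (l + 1)) : ℤ) : ℝ) * ∏ a, p a * q a := by
    refine nonneg_of_mul_nonneg_left ?_ (hsq (fun b : Fin l => p (d b.castSucc)) fun b => hp0 _)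
    rw [e4]
    linarith
  have hne : ∏ a, p a * q a ≠ 0 :=
    Finset.prod_ne_zero_iff.2 fun a _ => mul_ne_zero (hp0 a) (hq0 a)
  rw [sign_finRotate] at h1' h2''
  simp only [Nat.add_sub_cancel, show l + 2 - 1 = l + 1 from rfl, pow_succ] at h1' h2''
  push_cast at h1' h2''
  have hpow : ((-1 : ℝ)) ^ l * ∏ a, p a * q a ≠ 0 := mul_ne_zero (by simp) hne
  exact hpow (le_antisymm (by linarith) h2'')

end Cycle

/-! ### Spiders -/

/-- The rows `x` and columns `y` form a spider with three legs of length two in `Γ_A`: the centre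
`x 0` is adjacent to all `y j`, and `y j` is adjacent to the foot `x (j + 1)`. For a spider centred
at a column, use the transposed matrix. -/
structure IsSpider {α β : Type*} (A : Matrix α β ℝ) (x : Fin 4 → α) (y : Fin 3 → β) : Prop where
  injective_row : Function.Injective x
  injective_col : Function.Injective y
  centre_ne_zero : ∀ j, A (x 0) (y j) ≠ 0
  foot_ne_zero : ∀ j, A (x j.succ) (y j) ≠ 0

section Spider

variable {n m : ℕ} {A : Matrix (Fin n) (Fin m) ℝ}

lemma injective_pair {α β : Type*} {f : α → β} (hf : Function.Injective f) {a b : α} (hab : a ≠ b) :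
    Function.Injective ![f a, f b] := by
  intro i j hij
  fin_cases i <;> fin_cases j <;> simp_all [hf.eq_iff, eq_comm]

/-- On a spider, two tokens can be interchanged, because one of them may step aside into the
third leg. Each edge is used twice, so that the weight is positive, while a transposition has
sign `-1`. -/
lemma IsSpider.not_subset_P0Matrices {x : Fin 4 → Fin n} {y : Fin 3 → Fin m} (hA : IsSpider A x y) :
    ¬ evenQualProducts A 3 ⊆ P0Matrices n := by
  intro h
  let f : ℕ → Fin 2 → Fin n := fun s => match s with
    | 0 => ![x 0, x 2]
    | 1 => ![x 3, x 0]
    | 2 => ![x 0, x 1]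
    | _ => ![x 2, x 0]
  let g : ℕ → Fin 2 → Fin m := fun s => match s with
    | 0 => ![y 2, y 1]
    | 1 => ![y 2, y 0]
    | _ => ![y 1, y 0]
  have h1 := sign_mul_prod_nonneg (π := Equiv.swap 0 1) h (f := f) (g := g)
    (by rintro (_ | _ | _ | s) <;> exact injective_pair hA.injective_row (by decide))
    (by rintro (_ | _ | s) <;> exact injective_pair hA.injective_col (by decide))
    (by ext a; fin_cases a <;> rfl)
  have c := hA.centre_ne_zero
  have f1 : A (x 1) (y 0) ≠ 0 := hA.foot_ne_zero 0
  have f2 : A (x 2) (y 1) ≠ 0 := hA.foot_ne_zero 1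
  have f3 : A (x 3) (y 2) ≠ 0 := hA.foot_ne_zero 2
  rw [Equiv.Perm.sign_swap (by decide)] at h1
  simp only [Fin.prod_univ_two, Finset.prod_range_succ, Finset.prod_range_zero, f, g,
    Matrix.cons_val_zero, Matrix.cons_val_one] at h1
  push_cast at h1
  have h2 : 0 < (A (x 0) (y 0) * A (x 0) (y 1) * A (x 0) (y 2) * A (x 1) (y 0) * A (x 2) (y 1) *
      A (x 3) (y 2)) ^ 2 := by
    have := mul_ne_zero (mul_ne_zero (mul_ne_zero (mul_ne_zero (mul_ne_zero (c 0) (c 1)) (c 2)) f1)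
      f2) f3
    positivity
  linarith

lemma IsSpider.transpose_not_subset_P0Matrices {x : Fin 3 → Fin n} {y : Fin 4 → Fin m}
    (hA : IsSpider Aᵀ y x) : ¬ evenQualProducts A 3 ⊆ P0Matrices n := by
  intro h
  let f : ℕ → Fin 2 → Fin n := fun s => match s with
    | 0 => ![x 2, x 1]
    | 1 => ![x 2, x 0]
    | 2 => ![x 1, x 0]
    | _ => ![x 1, x 2]
  let g : ℕ → Fin 2 → Fin m := fun s => match s with
    | 0 => ![y 3, y 0]
    | 1 => ![y 0, y 1]
    | _ => ![y 2, y 0]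
  have h1 := sign_mul_prod_nonneg (π := Equiv.swap 0 1) h (f := f) (g := g)
    (by rintro (_ | _ | _ | s) <;> exact injective_pair hA.injective_col (by decide))
    (by rintro (_ | _ | s) <;> exact injective_pair hA.injective_row (by decide))
    (by ext a; fin_cases a <;> rfl)
  have c : ∀ j, A (x j) (y 0) ≠ 0 := hA.centre_ne_zero
  have f1 : A (x 0) (y 1) ≠ 0 := hA.foot_ne_zero 0
  have f2 : A (x 1) (y 2) ≠ 0 := hA.foot_ne_zero 1
  have f3 : A (x 2) (y 3) ≠ 0 := hA.foot_ne_zero 2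
  rw [Equiv.Perm.sign_swap (by decide)] at h1
  simp only [Fin.prod_univ_two, Finset.prod_range_succ, Finset.prod_range_zero, f, g,
    Matrix.cons_val_zero, Matrix.cons_val_one] at h1
  push_cast at h1
  have h2 : 0 < (A (x 0) (y 0) * A (x 1) (y 0) * A (x 2) (y 0) * A (x 0) (y 1) * A (x 1) (y 2) *
      A (x 2) (y 3)) ^ 2 := by
    have := mul_ne_zero (mul_ne_zero (mul_ne_zero (mul_ne_zero (mul_ne_zero (c 0) (c 1)) (c 2)) f1)
      f2) f3
    positivity
  linarith

/-- The matrix supported on a spider with weights `p` on the edges at the centre and `d` on the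
other ones, and with the signs `a` and `b` there. -/
def spiderMatrix (a b p d : Fin 3 → ℝ) : Matrix (Fin 4) (Fin 3) ℝ :=
  Matrix.of (Fin.cons (fun j => p j * a j) fun i j => if i = j then d j * b j else 0)

lemma isSubpattern_spiderMatrix {α β : Type*} {A : Matrix α β ℝ} {x : Fin 4 → α} {y : Fin 3 → β}
    {p d : Fin 3 → ℝ} (hp : ∀ j, 0 ≤ p j) (hd : ∀ j, 0 ≤ d j) :
    IsSubpattern (A.submatrix x y) (spiderMatrix
      (fun j => (SignType.sign (A (x 0) (y j)) : ℝ))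
      (fun j => (SignType.sign (A (x j.succ) (y j)) : ℝ)) p d) := by
  have key : ∀ c t : ℝ, 0 ≤ c → c * (SignType.sign t : ℝ) = 0 ∨
      SignType.sign (c * (SignType.sign t : ℝ)) = SignType.sign t := by
    intro c t hc
    rcases hc.eq_or_lt with rfl | hc
    · exact Or.inl (zero_mul _)
    · right
      rw [sign_mul, sign_pos hc, one_mul]
      rcases lt_trichotomy t 0 with h | h | h <;> simp [h]
  intro i j
  refine Fin.cases ?_ (fun i => ?_) i
  · exact key _ _ (hp j)
  · simp only [spiderMatrix, Matrix.of_apply, Fin.cons_succ, Matrix.submatrix_apply]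
    by_cases h : i = j
    · subst h
      simpa using key _ _ (hd i)
    · simp [h]

lemma spiderMatrix_transpose_mul {a b : Fin 3 → ℝ} (hb : ∀ j, b j * b j = 1)
    (p d q c : Fin 3 → ℝ) : (spiderMatrix a b p d)ᵀ * spiderMatrix a b q c =
      Matrix.of fun i j => p i * a i * (q j * a j) + if i = j then d j * c j else 0 := by
  ext i j
  rw [Matrix.mul_apply, Fin.sum_univ_succ]
  simp only [spiderMatrix, Matrix.transpose_apply, Matrix.of_apply, Fin.cons_zero, Fin.cons_succ]
  congr 1
  by_cases hij : i = j
  · subst hij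
    simp
    linear_combination d i * c i * hb i
  · simp [hij, Ne.symm hij]

/-- The nonreal number `(5 + i √7) / 2`, an eigenvalue of a suitable product on a spider. -/
lemma exists_root_not_mem_nonnegRealLine : ∃ z : ℂ, z ^ 2 = 5 * z - 8 ∧ z ∉ nonnegRealLine := by
  obtain ⟨z, hz⟩ := IsAlgClosed.exists_pow_nat_eq (-7 : ℂ) (n := 2) (by norm_num)
  refine ⟨(5 + z) / 2, by linear_combination hz / 4, ?_⟩
  rintro ⟨r, -, hr⟩
  have h1 : z = ((2 * r - 5 : ℝ) : ℂ) := by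
    push_cast
    linear_combination 2 * hr
  rw [h1] at hz
  have h2 : (2 * r - 5) ^ 2 = (-7 : ℝ) := by exact_mod_cast hz
  nlinarith [sq_nonneg (2 * r - 5)]

/-- Four weighted spider matrices, multiplied so as to act on the three columns, can give
the matrix with rows `(4, 2, 0)`, `(2, 5, 2)`, `(4, 2, 4)`, up to a signature similarity. Its
characteristic polynomial `(X - 8) (X ^ 2 - 5 X + 8)` has two nonreal roots. -/
lemma exists_spider_product_eigenvalue {a b : Fin 3 → ℝ} (ha : ∀ j, a j * a j = 1)
    (hb : ∀ j, b j * b j = 1) : ∃ p d : Fin 4 → Fin 3 → ℝ, (∀ i j, 0 ≤ p i j) ∧ (∀ i j, 0 ≤ d i j) ∧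
      ∃ z, z ∉ nonnegRealLine ∧ z ∈ complexSpectrum
        ((spiderMatrix a b (p 1) (d 1))ᵀ * spiderMatrix a b (p 2) (d 2) *
          ((spiderMatrix a b (p 3) (d 3))ᵀ * spiderMatrix a b (p 0) (d 0))) := by
  obtain ⟨z, hz, hzn⟩ := exists_root_not_mem_nonnegRealLine
  refine ⟨![![2, 1, 0], ![0, 1, 1], ![0, 0, 1], ![1, 0, 1]],
    ![![1, 1, 1], ![2, 2, 1], ![1, 1, 1], ![0, 2, 2]], ?_, ?_, z, hzn, ?_⟩
  · intro i j
    fin_cases i <;> fin_cases j <;> simp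
  · intro i j
    fin_cases i <;> fin_cases j <;> simp
  rw [spiderMatrix_transpose_mul hb, spiderMatrix_transpose_mul hb]
  have ha' : ∀ j, (a j : ℂ) * a j = 1 := fun j => by exact_mod_cast ha j
  refine mem_complexSpectrum_iff_exists.2 ⟨![2 * a 0, (z - 4) * a 1, (4 - 2 * z) * a 2], ?_, ?_⟩
  · intro h0
    have h1 : 2 * (a 0 : ℂ) = 0 := congrFun h0 0
    have h2 := ha' 0
    rw [(mul_eq_zero.1 h1).resolve_left two_ne_zero] at h2
    simp at h2
  · rw [map_ofReal_mul, ← Matrix.mulVec_mulVec]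
    ext i
    fin_cases i <;>
      simp [Matrix.mulVec, dotProduct, Fin.sum_univ_succ]
    · linear_combination 8 * (a 0 : ℂ) * ha' 0 + 2 * (a 0 : ℂ) * (z - 4) * ha' 1
    · linear_combination
        (a 1 : ℂ) * (4 * a 0 * a 0 + a 1 * a 1 * (z - 4) + 2 * (4 - 2 * z)) * ha' 2 +
          4 * (a 1 : ℂ) * ha' 0 + (a 1 : ℂ) * (z - 4) * ha' 1 - (a 1 : ℂ) * hz
    · linear_combination
        (a 2 : ℂ) * (4 * a 0 * a 0 + a 1 * a 1 * (z - 4) + 2 * (4 - 2 * z)) * ha' 2 +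
          8 * (a 2 : ℂ) * ha' 0 + 2 * (a 2 : ℂ) * (z - 4) * ha' 1 + 2 * (a 2 : ℂ) * hz

/-- The nonzero eigenvalues of `M * N` and `N * M` agree. -/
lemma mem_complexSpectrum_mul_comm {α β : Type*} [Fintype α] [DecidableEq α] [Fintype β]
    [DecidableEq β] {M : Matrix α β ℝ} {N : Matrix β α ℝ} {z : ℂ} (hz0 : z ≠ 0)
    (hz : z ∈ complexSpectrum (N * M)) : z ∈ complexSpectrum (M * N) := by
  obtain ⟨v, hv0, hv⟩ := mem_complexSpectrum_iff_exists.1 hz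
  rw [map_ofReal_mul, ← Matrix.mulVec_mulVec] at hv
  refine mem_complexSpectrum_iff_exists.2 ⟨M.map (fun x : ℝ => (x : ℂ)) *ᵥ v, fun h => ?_, ?_⟩
  · rw [h, Matrix.mulVec_zero] at hv
    exact smul_ne_zero hz0 hv0 hv.symm
  · rw [map_ofReal_mul, ← Matrix.mulVec_mulVec, hv, Matrix.mulVec_smul]

/-- If `𝒬⁴(A)` has nonnegative spectra, then so have the products of four degenerate factors whose
patterns are taken from a submatrix of `A`: bordered by zeros, they lie in the closure of `𝒬(A)`. -/
lemma complexSpectrum_subset_of_isSubpattern_submatrix {s t : ℕ}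
    (h : evenQualProducts A 2 ⊆ PSMatrices n) {x : Fin s → Fin n} {y : Fin t → Fin m}
    (hx : Function.Injective x) (hy : Function.Injective y) {N : Fin 4 → Matrix (Fin s) (Fin t) ℝ}
    (hN : ∀ i, IsSubpattern (A.submatrix x y) (N i)) :
    complexSpectrum (N 0 * (N 1)ᵀ * (N 2 * (N 3)ᵀ)) ⊆ nonnegRealLine := by
  have hP : ∀ i, IsSubpattern A (placement x * N i * (placement y)ᵀ) := fun i =>
    isSubpattern_placement hx hy (hN i)
  have h1 := listProd_mem_of_isSubpattern (isClosed_PSMatrices n) h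
    (B := ![placement x * N 0 * (placement y)ᵀ, placement x * N 2 * (placement y)ᵀ])
    (C := ![placement x * N 1 * (placement y)ᵀ, placement x * N 3 * (placement y)ᵀ])
    (by intro i; fin_cases i; exacts [hP 0, hP 2]) (by intro i; fin_cases i; exacts [hP 1, hP 3])
  have htr : ∀ i, (placement x * N i * (placement y)ᵀ)ᵀ =
      placement y * (N i)ᵀ * (placement x)ᵀ := by
    intro i
    rw [Matrix.transpose_mul, Matrix.transpose_mul, Matrix.transpose_transpose, Matrix.mul_assoc]
  simp only [List.ofFn_succ, List.ofFn_zero, List.prod_cons, List.prod_nil, Matrix.mul_one,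
    Matrix.cons_val_zero, Matrix.cons_val_succ, htr, placement_block_mul hy,
    placement_block_mul hx] at h1
  exact (complexSpectrum_subset_placement hx _).trans h1

lemma sign_mul_self_eq_one {t : ℝ} (ht : t ≠ 0) :
    (SignType.sign t : ℝ) * (SignType.sign t : ℝ) = 1 := by
  rcases lt_or_gt_of_ne ht with h | h <;> simp [h]

lemma IsSpider.not_subset_PSMatrices {x : Fin 4 → Fin n} {y : Fin 3 → Fin m} (hA : IsSpider A x y) :
    ¬ evenQualProducts A 2 ⊆ PSMatrices n := by
  intro h
  obtain ⟨p, d, hp, hd, z, hz, hzs⟩ := exists_spider_product_eigenvalue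
    (fun j => sign_mul_self_eq_one (hA.centre_ne_zero j))
    (fun j => sign_mul_self_eq_one (hA.foot_ne_zero j))
  have h1 := complexSpectrum_subset_of_isSubpattern_submatrix h hA.injective_row hA.injective_col
    fun i => isSubpattern_spiderMatrix (hp i) (hd i)
  refine hz (h1 ?_)
  rw [Matrix.mul_assoc]
  refine mem_complexSpectrum_mul_comm ?_ ?_
  · rintro rfl
    exact hz ⟨0, le_rfl, by simp⟩
  · simpa only [Matrix.mul_assoc] using hzs

lemma IsSpider.transpose_not_subset_PSMatrices {x : Fin 3 → Fin n} {y : Fin 4 → Fin m}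
    (hA : IsSpider Aᵀ y x) : ¬ evenQualProducts A 2 ⊆ PSMatrices n := by
  intro h
  obtain ⟨p, d, hp, hd, z, hz, hzs⟩ := exists_spider_product_eigenvalue
    (fun j => sign_mul_self_eq_one (hA.centre_ne_zero j))
    (fun j => sign_mul_self_eq_one (hA.foot_ne_zero j))
  have h2 := fun i => isSubpattern_spiderMatrix (A := Aᵀ) (x := y) (y := x) (hp i) (hd i)
  have h1 := complexSpectrum_subset_of_isSubpattern_submatrix h hA.injective_col hA.injective_row
    (N := fun i => (spiderMatrix (fun j => (SignType.sign (Aᵀ (y 0) (x j)) : ℝ))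
      (fun j => (SignType.sign (Aᵀ (y j.succ) (x j)) : ℝ)) (p (i + 1)) (d (i + 1)))ᵀ)
    fun i a b => h2 (i + 1) b a
  exact hz (h1 hzs)

end Spider

/-! ### Forests that are not caterpillar forests -/

/-- A finite tree (or the empty graph) without vertices of degree three or more is a path: no edge
leads from a longest path in it to a vertex outside. -/
lemma exists_iso_pathGraph {V : Type*} [Finite V] {G : SimpleGraph V} (hconn : G.Preconnected)
    (hacyc : G.IsAcyclic)
    (hdeg : ∀ v a b c, G.Adj v a → G.Adj v b → G.Adj v c → a = b ∨ a = c ∨ b = c) :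
    ∃ p : ℕ, Nonempty (G ≃g SimpleGraph.pathGraph p) := by
  classical
  rcases isEmpty_or_nonempty V with hV | hV
  · exact ⟨0, ⟨⟨Equiv.equivOfIsEmpty _ _, fun {a} => isEmptyElim a⟩⟩⟩
  obtain ⟨u, v, w, hw, hmax⟩ := SimpleGraph.Walk.exists_isPath_forall_isPath_length_le_length G
  have hclosed : ∀ a b, G.Adj a b → a ∈ w.support → b ∈ w.support := by
    intro a b hab ha
    by_contra hb
    obtain ⟨i, rfl, hi⟩ := SimpleGraph.Walk.mem_support_iff_exists_getVert.1 ha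
    have hne : ∀ j, w.getVert j ≠ b := fun j h => hb (h ▸ w.getVert_mem_support j)
    rcases Nat.eq_zero_or_pos i with rfl | hi0
    · rw [SimpleGraph.Walk.getVert_zero] at hab
      have := hmax _ _ (SimpleGraph.Walk.cons hab.symm w) (hw.cons hb)
      simp at this
    · rcases hi.eq_or_lt with rfl | hlt
      · rw [SimpleGraph.Walk.getVert_length] at hab
        have := hmax _ _ (w.concat hab) (hw.concat hb hab)
        simp at this
      · have h1 := w.adj_getVert_succ hlt
        have h2 := w.adj_getVert_succ (i := i - 1) (by omega)
        rw [Nat.sub_add_cancel hi0] at h2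
        rcases hdeg _ _ _ _ h1 h2.symm hab with h | h | h
        · have := hw.getVert_injOn (by simp; omega) (by simp; omega) h
          omega
        · exact hne _ h
        · exact hne _ h
  have hall : ∀ a, a ∈ w.support := by
    intro a
    obtain ⟨q⟩ := hconn u a
    have : ∀ {b c} (_ : G.Walk b c), b ∈ w.support → c ∈ w.support := by
      intro b c q
      induction q with
      | nil => exact id
      | cons h _ ih => exact fun hb => ih (hclosed _ _ h hb)
    exact this q w.start_mem_support
  let φ : Fin (w.length + 1) ≃ V := Equiv.ofBijective (fun i => w.getVert i)
    ⟨fun i j hij => Fin.ext (hw.getVert_injOn (by simp; omega) (by simp; omega) hij), fun a => by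
      obtain ⟨i, hi, hle⟩ := SimpleGraph.Walk.mem_support_iff_exists_getVert.1 (hall a)
      exact ⟨⟨i, by omega⟩, hi⟩⟩
  have hlt : ∀ i j, i < j → j ≤ w.length → G.Adj (w.getVert i) (w.getVert j) → i + 1 = j := by
    intro i j hij hj h
    have hmem : w.getVert j ∈ (w.drop i).support := by
      rw [SimpleGraph.Walk.mem_support_iff_exists_getVert]
      exact ⟨j - i, by rw [SimpleGraph.Walk.drop_getVert]; congr 1; omega, by
        rw [SimpleGraph.Walk.drop_length]; omega⟩
    have h1 := hacyc.eq_snd_of_adj_start (hw.drop i) h hmem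
    rw [SimpleGraph.Walk.snd, SimpleGraph.Walk.drop_getVert] at h1
    exact (hw.getVert_injOn (by simp; omega) (by simp; omega) h1).symm
  refine ⟨w.length + 1, ⟨SimpleGraph.Iso.symm ⟨φ, fun {i j} => ?_⟩⟩⟩
  change G.Adj (w.getVert i) (w.getVert j) ↔ _
  rw [SimpleGraph.pathGraph_adj]
  constructor
  · intro h
    rcases lt_trichotomy (i : ℕ) j with hij | hij | hij
    · exact Or.inl (hlt i j hij (by omega) h)
    · rw [hij] at h
      exact absurd h (G.loopless.irrefl _)
    · exact Or.inr (hlt j i hij (by omega) h.symm)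
  · rintro (h | h)
    · rw [← h]
      exact w.adj_getVert_succ (by omega)
    · rw [← h]
      exact (w.adj_getVert_succ (by omega)).symm

/-- A tree that is not a caterpillar contains a spider with three legs of length two: its
subgraph of non-leaves is a tree but not a path, hence has a vertex of degree three. -/
lemma exists_spider_of_not_isCaterpillar {V : Type*} [Finite V] {G : SimpleGraph V} (hG : G.IsTree)
    (h : ¬ IsCaterpillar G) : ∃ (v : V) (a b : Fin 3 → V), Function.Injective a ∧
      ∀ i, G.Adj v (a i) ∧ G.Adj (a i) (b i) ∧ b i ≠ v := by
  by_contra hno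
  refine h ⟨hG, exists_iso_pathGraph ?_ (hG.isAcyclic.induce _) ?_⟩
  · refine hG.connected.preconnected.induce_of_degree_eq_one fun v hv => ?_
    have hleaf : IsLeaf G v := not_not.1 hv
    exact fun a ha b hb => hleaf.unique ha hb
  · rintro ⟨v, hv⟩ ⟨a, ha⟩ ⟨b, hb⟩ ⟨c, hc⟩ hva hvb hvc
    by_contra! hne
    simp only [ne_eq, Subtype.mk.injEq] at hne
    have hother : ∀ u, ¬ IsLeaf G u → G.Adj v u → ∃ w, G.Adj u w ∧ w ≠ v := by
      intro u hu hvu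
      by_contra! hcon
      exact hu ⟨v, hvu.symm, hcon⟩
    obtain ⟨a', ha', hav⟩ := hother a ha hva
    obtain ⟨b', hb', hbv⟩ := hother b hb hvb
    obtain ⟨c', hc', hcv⟩ := hother c hc hvc
    refine hno ⟨v, ![a, b, c], ![a', b', c'], ?_, ?_⟩
    · intro i j hij
      fin_cases i <;> fin_cases j <;> simp_all [eq_comm]
    · intro i
      fin_cases i
      exacts [⟨hva, ha', hav⟩, ⟨hvb, hb', hbv⟩, ⟨hvc, hc', hcv⟩]

lemma SimpleGraph.IsAcyclic.eq_of_common_neighbors {V : Type*} {G : SimpleGraph V}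
    (hG : G.IsAcyclic) {v w a b : V} (hvw : w ≠ v) (ha : G.Adj v a) (ha' : G.Adj a w)
    (hb : G.Adj v b) (hb' : G.Adj b w) : a = b := by
  have hpath : ∀ {c} (h : G.Adj v c) (h' : G.Adj c w),
      (SimpleGraph.Walk.cons h (SimpleGraph.Walk.cons h' SimpleGraph.Walk.nil)).IsPath := by
    intro c h h'
    simp [h.ne, h'.ne, hvw.symm]
  have := (hG.subsingleton_path v w).elim ⟨_, hpath ha ha'⟩ ⟨_, hpath hb hb'⟩
  exact congrArg (fun p : G.Path v w => (p : G.Walk v w).getVert 1) this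

section Obstructions

variable {n m : ℕ} {A : Matrix (Fin n) (Fin m) ℝ}

lemma exists_eq_inr_of_adj_inl {i : Fin n} {v : Fin n ⊕ Fin m}
    (h : (bipartiteGraph A).Adj (Sum.inl i) v) : ∃ j, v = Sum.inr j ∧ A i j ≠ 0 := by
  rcases v with i' | j
  · exact h.elim
  · exact ⟨j, rfl, h⟩

lemma exists_eq_inl_of_adj_inr {j : Fin m} {v : Fin n ⊕ Fin m}
    (h : (bipartiteGraph A).Adj (Sum.inr j) v) : ∃ i, v = Sum.inl i ∧ A i j ≠ 0 := by
  rcases v with i | j'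
  · exact ⟨i, rfl, h⟩
  · exact h.elim

/-- A cycle of `Γ_A` has even length at least four; started at a row, it lists rows and columns
alternately. -/
lemma exists_isRowColumnCycle (h : ¬ (bipartiteGraph A).IsAcyclic) :
    ∃ (l : ℕ) (x : Fin (l + 2) → Fin n) (y : Fin (l + 2) → Fin m), IsRowColumnCycle A x y := by
  classical
  obtain ⟨i, w, hw⟩ : ∃ (i : Fin n) (w : (bipartiteGraph A).Walk (Sum.inl i) (Sum.inl i)),
      w.IsCycle := by
    simp only [SimpleGraph.IsAcyclic, not_forall, not_not] at h
    obtain ⟨v, w, hw⟩ := h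
    rcases v with i | j
    · exact ⟨i, w, hw⟩
    · obtain ⟨i, hi, -⟩ := exists_eq_inl_of_adj_inr (w.adj_snd hw.not_nil)
      have hmem : Sum.inl i ∈ w.support := hi ▸ w.getVert_mem_support 1
      exact ⟨i, w.rotate _ hmem, hw.rotate hmem⟩
  have halt : ∀ s, (2 * s ≤ w.length → ∃ i, w.getVert (2 * s) = Sum.inl i) ∧
      (2 * s + 1 ≤ w.length → ∃ j, w.getVert (2 * s + 1) = Sum.inr j) := by
    have hodd : ∀ s, 2 * s + 1 ≤ w.length → (∃ i, w.getVert (2 * s) = Sum.inl i) →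
        ∃ j, w.getVert (2 * s + 1) = Sum.inr j := by
      rintro s hs ⟨i, hi⟩
      have := w.adj_getVert_succ (i := 2 * s) (by omega)
      rw [hi] at this
      obtain ⟨j, hj, -⟩ := exists_eq_inr_of_adj_inl this
      exact ⟨j, hj⟩
    intro s
    induction s with
    | zero =>
      have h0 : ∃ i, w.getVert (2 * 0) = Sum.inl i := ⟨i, by simp⟩
      exact ⟨fun _ => h0, fun hs => hodd 0 hs h0⟩
    | succ s ih =>
      have h0 : 2 * (s + 1) ≤ w.length → ∃ i, w.getVert (2 * (s + 1)) = Sum.inl i := by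
        intro hs
        obtain ⟨j, hj⟩ := ih.2 (by omega)
        have := w.adj_getVert_succ (i := 2 * s + 1) (by omega)
        rw [hj] at this
        obtain ⟨i, hi, -⟩ := exists_eq_inl_of_adj_inr this
        exact ⟨i, hi⟩
      exact ⟨h0, fun hs => hodd (s + 1) hs (h0 (by omega))⟩
  have hlen := hw.three_le_length
  obtain ⟨l, hl⟩ : ∃ l, w.length = 2 * (l + 2) := by
    rcases Nat.even_or_odd' w.length with ⟨k, hk | hk⟩
    · exact ⟨k - 2, by omega⟩
    · obtain ⟨j, hj⟩ := (halt k).2 hk.ge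
      rw [← hk, SimpleGraph.Walk.getVert_length] at hj
      cases hj
  have hx : ∀ a : Fin (l + 2), ∃ i, w.getVert (2 * a) = Sum.inl i :=
    fun a => (halt a).1 (by omega)
  have hy : ∀ a : Fin (l + 2), ∃ j, w.getVert (2 * a + 1) = Sum.inr j :=
    fun a => (halt a).2 (by omega)
  choose x hx using hx
  choose y hy using hy
  have hrot : ∀ a : Fin (l + 2), w.getVert (2 * a + 1 + 1) = Sum.inl (x (finRotate (l + 2) a)) := by
    intro a
    rw [← hx]
    by_cases ha : a = Fin.last (l + 1)
    · subst ha
      rw [finRotate_last]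
      have : 2 * ((Fin.last (l + 1) : Fin (l + 2)) : ℕ) + 1 + 1 = w.length := by
        rw [hl, Fin.val_last]
        ring
      rw [this, SimpleGraph.Walk.getVert_length]
      simp
    · rw [coe_finRotate_of_ne_last ha]
      congr 1
  refine ⟨l, x, y, ⟨fun a b hab => ?_, fun a b hab => ?_, fun a => ?_, fun a => ?_⟩⟩
  · have h1 : w.getVert (2 * a) = w.getVert (2 * b) := by rw [hx, hx, hab]
    have := hw.getVert_injOn' (by simp only [Set.mem_ofPred_eq]; omega)
      (by simp only [Set.mem_ofPred_eq]; omega) h1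
    exact Fin.ext (by omega)
  · have h1 : w.getVert (2 * a + 1) = w.getVert (2 * b + 1) := by rw [hy, hy, hab]
    have := hw.getVert_injOn' (by simp only [Set.mem_ofPred_eq]; omega)
      (by simp only [Set.mem_ofPred_eq]; omega) h1
    exact Fin.ext (by omega)
  · have := w.adj_getVert_succ (i := 2 * a) (by omega)
    rw [hx, hy] at this
    exact this
  · have := w.adj_getVert_succ (i := 2 * a + 1) (by omega)
    rw [hy, hrot] at this
    exact this

/-- If `Γ_A` is not a caterpillar forest, it contains a cycle or a spider. -/
lemma exists_obstruction (h : ¬ IsCaterpillarForest (bipartiteGraph A)) :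
    (∃ (l : ℕ) (x : Fin (l + 2) → Fin n) (y : Fin (l + 2) → Fin m), IsRowColumnCycle A x y) ∨
      (∃ x y, IsSpider A x y) ∨ ∃ x y, IsSpider Aᵀ y x := by
  by_cases hacyc : (bipartiteGraph A).IsAcyclic
  swap
  · exact Or.inl (exists_isRowColumnCycle hacyc)
  right
  obtain ⟨c, hc⟩ : ∃ c : (bipartiteGraph A).ConnectedComponent, ¬ IsCaterpillar c.toSimpleGraph := by
    by_contra! hcon
    exact h ⟨hacyc, hcon⟩
  obtain ⟨v, a, b, ha, hab⟩ :=
    exists_spider_of_not_isCaterpillar (hacyc.isTree_connectedComponent c) hc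
  have hb : Function.Injective b := by
    intro i j hij
    refine ha ((hacyc.isTree_connectedComponent c).isAcyclic.eq_of_common_neighbors (hab i).2.2
      (hab i).1 (hab i).2.1 (hab j).1 ?_)
    rw [hij]
    exact (hab j).2.1
  have h1 : ∀ k, (bipartiteGraph A).Adj v.1 (a k).1 := fun k => (hab k).1
  have h2 : ∀ k, (bipartiteGraph A).Adj (a k).1 (b k).1 := fun k => (hab k).2.1
  have h3 : ∀ k, (b k).1 ≠ v.1 := fun k hk => (hab k).2.2 (Subtype.ext hk)
  have ha' : Function.Injective fun k => (a k).1 := Subtype.val_injective.comp ha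
  have hb' : Function.Injective fun k => (b k).1 := Subtype.val_injective.comp hb
  obtain ⟨v, hv⟩ := v
  rcases v with i₀ | j₀
  · left
    choose y hy hy0 using fun k => exists_eq_inr_of_adj_inl (h1 k)
    choose x hx hx0 using fun k => exists_eq_inl_of_adj_inr (hy k ▸ h2 k)
    refine ⟨Fin.cons i₀ x, y, ⟨?_, fun k l hkl => ha' (by simp [hy, hkl]), hy0, hx0⟩⟩
    rw [Fin.cons_injective_iff]
    refine ⟨?_, fun k l hkl => hb' (by simp [hx, hkl])⟩
    rintro ⟨k, hk⟩
    exact h3 k (by rw [hx, hk])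
  · right
    choose x hx hx0 using fun k => exists_eq_inl_of_adj_inr (h1 k)
    choose y hy hy0 using fun k => exists_eq_inr_of_adj_inl (hx k ▸ h2 k)
    refine ⟨x, Fin.cons j₀ y, ⟨?_, fun k l hkl => ha' (by simp [hx, hkl]), hx0, hy0⟩⟩
    rw [Fin.cons_injective_iff]
    refine ⟨?_, fun k l hkl => hb' (by simp [hy, hkl])⟩
    rintro ⟨k, hk⟩
    exact h3 k (by rw [hy, hk])

end Obstructions

/-! ### The equivalence -/

theorem theorem3 {n m : ℕ} (A : Matrix (Fin n) (Fin m) ℝ) :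
    List.TFAE
      [ IsCaterpillarForest (bipartiteGraph A),
        evenQualProducts A 3 ⊆ P0Matrices n,
        evenQualProducts A 2 ⊆ PSMatrices n,
        ∀ k : ℕ, 1 ≤ k → evenQualProducts A k ⊆ P0Matrices n,
        ∀ k : ℕ, 1 ≤ k → evenQualProducts A k ⊆ PSMatrices n ] := by
  tfae_have 1 → 4 := fun h k _ => h.evenQualProducts_subset_P0Matrices k
  tfae_have 1 → 5 := fun h k _ => h.evenQualProducts_subset_PSMatrices k
  tfae_have 4 → 2 := fun h => h 3 (by norm_num)
  tfae_have 5 → 3 := fun h => h 2 (by norm_num)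
  tfae_have 2 → 1 := by
    intro h
    by_contra hA
    rcases exists_obstruction hA with ⟨l, x, y, hc⟩ | ⟨x, y, hs⟩ | ⟨x, y, hs⟩
    exacts [hc.not_subset_P0Matrices h, hs.not_subset_P0Matrices h,
      hs.transpose_not_subset_P0Matrices h]
  tfae_have 3 → 1 := by
    intro h
    by_contra hA
    rcases exists_obstruction hA with ⟨l, x, y, hc⟩ | ⟨x, y, hs⟩ | ⟨x, y, hs⟩
    exacts [hc.not_subset_PSMatrices h, hs.not_subset_PSMatrices h,
      hs.transpose_not_subset_PSMatrices h]
  tfae_finish
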